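/- \textbf{Model.} A network on $n$ nodes is a simple graph $g$ on a set $N$ of $n$ nodes. Let $l(y,z)$ be the graph distance, $d_j$ the degree of $j$, and, for connected $y,z$, let $E(y,z)$ be the set of nodes other than $y,z$ that lie on every path joining $y$ and $z$ (with $E(y,z)=\emptyset$ if $y,z$ are not connected), $e(y,z)=|E(y,z)|$. Fix benefits $b_1>b_2>b_3>\dots$ with all $b_i\ge 0$, a link cost $c$, an entry factor $c_0$ and a rent fraction $\gamma\ge 0$. The utility of $j$ in $g$ is \[ u_j(g)=d_j(b_1-c)+\sum_{w:\,1<l(j,w)<\infty} b_{l(j,w)}-\sum_{w:\,E(j,w)\ne\emptyset}\gamma\, b_{l(j,w)}+\sum_{\{y,z\}:\,j\in E(y,z)}\frac{\gamma}{e(y,z)}\,2b_{l(y,z)} , \] the last sum being over unordered pairs of nodes. The network $g$ is \emph{pairwise stable} if (a) $u_i(g\setminus ij)\le u_i(g)$ for every link $ij$ and each of its ends $i$, and (b) for every non-link $ij$, $u_i(g\cup ij)>u_i(g)$ implies $u_j(g\cup ij)<u_j(g)$. \emph{Process.} Start with one node. When a node $i$ gets to move, it plays a myopic best response: among keeping $g$,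 deleting one of its links, and creating a link with a node $j$ whose utility does not decrease thereby, it makes a choice that maximises its own utility, and it alters a link only if its utility strictly increases. When (and only when) the network is pairwise stable, a new node $x$ may enter, by linking to an existing node $t$ of $g$ with $u_t(g\cup xt)\ge u_t(g)$; among such $t$ it makes a choice that maximises $u_x(g\cup xt)-c_0\,d_t(g)$, and it enters only if this maximum is strictly positive. After an entry, nodes move in an arbitrary order, one at a time, until the network is pairwise stable again. A run of moves is \emph{fair} if every node gets to move infinitely often (as happens almost surely when movers are drawn independently and uniformly at random). \textbf{Theorem.} Suppose \[ \gamma<\frac{b_2-b_3}{3b_2-b_3},\qquad b_1-b_2+\gamma(3b_2-b_3)<c<b_1-b_3,\qquad (1-\gamma)(b_2-b_3)<c_0\le(1-\gamma)b_2 . \] Then, for every order of moves and every resolution of ties: \begin{enumerate} \item every pairwise stable network on $n$ nodes that arises in the process is a bipartite Tur\'an graph, i.e. a complete bipartite graph on $n$ nodes whose sides differ in size by at most one; \item from every network that arises, every fair run of moves reaches a pairwise stable network after finitely many moves and never leaves it; \item whenever a pairwise stable network has arisen, the next node does enter; \item for every $n\ge 1$ some pairwise stable network on $n$ nodes does arise;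 \item if a new node $x$ enters a pairwise stable network $g$ that has arisen, then $g$ is complete bipartite with sides $L,S$, $|S|\le|L|\le|S|+1$, such that the first link of $x$ is with a node $t\in L$ (the larger side, or either side if the sizes are equal); every network reached by the subsequent moves is $g$ together with links from $x$ to all nodes of some set $K$ with $t\in K\subseteq L$; every move that alters such a network creates a link between $x$ and a node of $L\setminus K$; and such a network is pairwise stable if and only if $K=L$. \end{enumerate} -/

import Mathlib

/-!
Recursive network formation by self-interested nodes.

Nodes are labelled `0, 1, 2, …` in the order in which they enter. A network on `n` nodes is a
graph `G : SimpleGraph ℕ` together with the number `n`; the nodes present are the elements of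
`Finset.range n`, and all the links that ever arise join nodes present.
-/

namespace NetForm

/-- The parameters of the utility model: `b i` is the benefit obtained from a node at distance `i`
in the absence of rents (`b 0` is never used), `c` is the cost of a link, `c₀` is the network entry
factor, and `γ` is the fraction of indirect benefits paid to the essential nodes. -/
structure Params where
  b : ℕ → ℝ
  c : ℝ
  c₀ : ℝ
  γ : ℝ

open scoped Classical in
/-- The degree `d_j` of node `j` in the network `G` on `n` nodes. -/
noncomputable def degree (n : ℕ) (G : SimpleGraph ℕ) (j : ℕ) : ℕ :=
  ((Finset.range n).filter fun w => G.Adj j w).card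

open scoped Classical in
/-- The set `E(y, z)` of the nodes that are essential to connect `y` and `z`: the nodes, other than
`y` and `z` themselves, that lie on every path joining `y` and `z`. There are none if `y` and `z`
are not connected. -/
noncomputable def essential (n : ℕ) (G : SimpleGraph ℕ) (y z : ℕ) : Finset ℕ :=
  (Finset.range n).filter fun x =>
    x ≠ y ∧ x ≠ z ∧ G.Reachable y z ∧ ∀ p : G.Walk y z, p.IsPath → x ∈ p.support

open scoped Classical in
/-- The utility of node `j` in the network `G` on `n` nodes, apart from the network entry fee:
direct benefits minus link costs, plus indirect benefits, minus intermediation rents, plus bridging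
benefits. Nodes that are not connected to `j` contribute nothing (their `G.dist` is `0`, so they
do not satisfy `1 < G.dist j w`). The last sum is over unordered pairs `{y, z}`. -/
noncomputable def utility (P : Params) (n : ℕ) (G : SimpleGraph ℕ) (j : ℕ) : ℝ :=
  (degree n G j : ℝ) * (P.b 1 - P.c)
    + ∑ w ∈ (Finset.range n).filter (fun w => 1 < G.dist j w), P.b (G.dist j w)
    - ∑ w ∈ (Finset.range n).filter (fun w => (essential n G j w).Nonempty),
        P.γ * P.b (G.dist j w)
    + ∑ y ∈ Finset.range n,
        ∑ z ∈ (Finset.range n).filter (fun z => y < z ∧ j ∈ essential n G y z),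
          P.γ / ((essential n G y z).card : ℝ) * (2 * P.b (G.dist y z))

/-- The network obtained by creating the link `ij`. -/
def addLink (G : SimpleGraph ℕ) (i j : ℕ) : SimpleGraph ℕ := G ⊔ SimpleGraph.edge i j

/-- The network obtained by deleting the link `ij`. -/
def deleteLink (G : SimpleGraph ℕ) (i j : ℕ) : SimpleGraph ℕ := G \ SimpleGraph.edge i j

/-- Pairwise stability: no node gains by deleting one of its links, and whenever one of two
unlinked nodes would gain by a link between them, the other one would lose. -/
def PairwiseStable (P : Params) (n : ℕ) (G : SimpleGraph ℕ) : Prop :=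
  (∀ i < n, ∀ j < n, G.Adj i j → utility P n (deleteLink G i j) i ≤ utility P n G i) ∧
  (∀ i < n, ∀ j < n, i ≠ j → ¬ G.Adj i j →
    utility P n G i < utility P n (addLink G i j) i →
      utility P n (addLink G i j) j < utility P n G j)

/-- The networks among which node `i` chooses when it gets to move in the network `G` on `n` nodes:
the present one, those obtained by creating a link with a node whose utility does not
decrease thereby, and those obtained by deleting one of its own links. -/
def Available (P : Params) (n : ℕ) (G : SimpleGraph ℕ) (i : ℕ) (H : SimpleGraph ℕ) : Prop :=
  H = G ∨
  (∃ j < n, j ≠ i ∧ ¬ G.Adj i j ∧ H = addLink G i j ∧ utility P n G j ≤ utility P n H j) ∨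
  (∃ j < n, G.Adj i j ∧ H = deleteLink G i j)

/-- `H` results from a myopic best response of node `i` in the network `G` on `n` nodes: it
maximises the utility of `i` among the available networks, and `i` alters a link only if this
strictly increases its utility. -/
def BestResponse (P : Params) (n : ℕ) (G : SimpleGraph ℕ) (i : ℕ) (H : SimpleGraph ℕ) : Prop :=
  Available P n G i H ∧
  (∀ H', Available P n G i H' → utility P n H' i ≤ utility P n H i) ∧
  (H = G ∨ utility P n G i < utility P n H i)

/-- Some node of the network on `n` nodes gets to move, and plays a best response. -/
def Step (P : Params) (n : ℕ) (G H : SimpleGraph ℕ) : Prop :=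
  ∃ i < n, BestResponse P n G i H

/-- The utility of the newly entering node `n` if it enters the network `G` on the nodes
`0, …, n - 1` by a link with node `t`; it pays the entry fee `c₀ * d_t`. -/
noncomputable def entryUtility (P : Params) (n : ℕ) (G : SimpleGraph ℕ) (t : ℕ) : ℝ :=
  -P.c₀ * (degree n G t : ℝ) + utility P (n + 1) (addLink G n t) n

/-- Node `t` of the network `G` on `n` nodes accepts a first link from the newly entering node. -/
def AcceptsEntry (P : Params) (n : ℕ) (G : SimpleGraph ℕ) (t : ℕ) : Prop :=
  t < n ∧ utility P n G t ≤ utility P (n + 1) (addLink G n t) t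

/-- It is a best response of the newly entering node `n` to enter the network `G` on `n` nodes by a
link with node `t`. Staying out has utility `0`, and the node enters only if it strictly gains. -/
def EntryResponse (P : Params) (n : ℕ) (G : SimpleGraph ℕ) (t : ℕ) : Prop :=
  AcceptsEntry P n G t ∧ 0 < entryUtility P n G t ∧
    ∀ s, AcceptsEntry P n G s → entryUtility P n G s ≤ entryUtility P n G t

/-- `Arises P n G`: the network `G` on `n` nodes can arise in the recursive formation process. The
process starts with a single node; at any time some node moves and plays a best response; a new
node may enter only when the network is pairwise stable. -/
inductive Arises (P : Params) : ℕ → SimpleGraph ℕ → Prop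
  | start : Arises P 1 ⊥
  | move {n : ℕ} {G H : SimpleGraph ℕ} : Arises P n G → Step P n G H → Arises P n H
  | enter {n : ℕ} {G : SimpleGraph ℕ} {t : ℕ} : Arises P n G → PairwiseStable P n G →
      EntryResponse P n G t → Arises P (n + 1) (addLink G n t)

/-- A fair run of the adjustment process on `n` nodes from `G`: node `m k` plays a best response at
time `k`, and every node gets to move infinitely often. -/
def FairRun (P : Params) (n : ℕ) (G : SimpleGraph ℕ) (m : ℕ → ℕ) (g : ℕ → SimpleGraph ℕ) : Prop :=
  g 0 = G ∧ (∀ k, m k < n ∧ BestResponse P n (g k) (m k) (g (k + 1))) ∧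
    ∀ i < n, ∀ K, ∃ k ≥ K, m k = i

/-- The network `G` on `n` nodes is a bipartite Turán graph. -/
def IsBipartiteTuran (n : ℕ) (G : SimpleGraph ℕ) : Prop :=
  Nonempty (G.comap (Fin.val : Fin n → ℕ) ≃g SimpleGraph.turanGraph n 2)

/-- `G` is the complete bipartite network on `n` nodes with sides `L` and `S`, where `L` is the
larger one or, if the sizes are equal, either one, and the sizes differ by at most one. -/
def IsTuranSides (n : ℕ) (G : SimpleGraph ℕ) (L S : Finset ℕ) : Prop :=
  Disjoint L S ∧ L ∪ S = Finset.range n ∧ S.card ≤ L.card ∧ L.card ≤ S.card + 1 ∧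
    ∀ v w, G.Adj v w ↔ (v ∈ L ∧ w ∈ S) ∨ (v ∈ S ∧ w ∈ L)

/-- The network obtained from `G` by links between the node `x` and all the elements of `K`. -/
def joinTo (G : SimpleGraph ℕ) (x : ℕ) (K : Finset ℕ) : SimpleGraph ℕ :=
  G ⊔ ⨆ s ∈ K, SimpleGraph.edge x s

end NetForm

namespace NetForm

open SimpleGraph

section Graph

variable {n : ℕ} {G H : SimpleGraph ℕ} {i j x y z : ℕ}

theorem mem_essential :
    x ∈ essential n G y z ↔
      x < n ∧ x ≠ y ∧ x ≠ z ∧ G.Reachable y z ∧ ∀ p : G.Walk y z, x ∈ p.support := by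
  classical
  simp only [essential, Finset.mem_filter, Finset.mem_range]
  refine and_congr_right fun _ => and_congr_right fun _ => and_congr_right fun _ =>
    and_congr_right fun _ => ⟨fun h p => ?_, fun h p _ => h p⟩
  exact p.support_bypass_subset_support (h _ p.bypass_isPath)

theorem essential_comm : essential n G y z = essential n G z y := by
  have key : ∀ y z, essential n G y z ⊆ essential n G z y := by
    intro y z x hx
    rw [mem_essential] at hx ⊢
    obtain ⟨h1, h2, h3, h4, h5⟩ := hx
    exact ⟨h1, h3, h2, h4.symm, fun p => by simpa using h5 p.reverse⟩
  exact (key y z).antisymm (key z y)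

theorem essential_subset_of_le (h : G ≤ H) (hr : G.Reachable y z) :
    essential n H y z ⊆ essential n G y z := by
  intro x hx
  rw [mem_essential] at hx ⊢
  obtain ⟨h1, h2, h3, -, h5⟩ := hx
  exact ⟨h1, h2, h3, hr, fun p => by simpa using h5 (p.mapLe h)⟩

theorem notMem_essential_of_adj (h : G.Adj y z) : x ∉ essential n G y z := by
  intro hx
  rw [mem_essential] at hx
  obtain ⟨-, h2, h3, -, h5⟩ := hx
  have := h5 h.toWalk
  simp [h2, h3] at this

theorem notMem_essential_of_two {m : ℕ} (h : G.Adj y m) (h' : G.Adj m z) (hm : x ≠ m) :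
    x ∉ essential n G y z := by
  intro hx
  rw [mem_essential] at hx
  obtain ⟨-, h2, h3, -, h5⟩ := hx
  have := h5 (.cons h h'.toWalk)
  simp [h2, h3, hm] at this

theorem notMem_essential_of_three {m l : ℕ} (h : G.Adj y m) (h' : G.Adj m l) (h'' : G.Adj l z)
    (hm : x ≠ m) (hl : x ≠ l) : x ∉ essential n G y z := by
  intro hx
  rw [mem_essential] at hx
  obtain ⟨-, h2, h3, -, h5⟩ := hx
  have := h5 (.cons h (.cons h' h''.toWalk))
  simp [h2, h3, hm, hl] at this

theorem essential_eq_empty_of_adj (h : G.Adj y z) : essential n G y z = ∅ :=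
  Finset.eq_empty_of_forall_notMem fun _ => notMem_essential_of_adj h

theorem essential_eq_empty_of_dist (h : G.dist y z = 0) : essential n G y z = ∅ := by
  refine Finset.eq_empty_of_forall_notMem fun x hx => ?_
  rw [mem_essential] at hx
  obtain ⟨-, h2, h3, h4, h5⟩ := hx
  obtain rfl := h4.dist_eq_zero_iff.1 h
  simpa [h2] using h5 .nil

/-- The unique neighbour of a leaf is essential to connect it with the other nodes. -/
theorem mem_essential_of_leaf (hx : x < n) (hr : G.Reachable y z) (hy : x ≠ y) (hz : x ≠ z)
    (hyz : y ≠ z) (h : ∀ w, G.Adj y w → w = x) : x ∈ essential n G y z := by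
  rw [mem_essential]
  refine ⟨hx, hy, hz, hr, fun p => ?_⟩
  cases p with
  | nil => exact absurd rfl hyz
  | cons a q => obtain rfl := h _ a; simp

theorem leaf_notMem_essential {t : ℕ} (h : ∀ w, G.Adj x w → w = t) : x ∉ essential n G y z := by
  classical
  intro hx
  obtain ⟨-, h2, h3, h4, h5⟩ := mem_essential.1 hx
  obtain ⟨p, hp⟩ := h4.exists_isPath
  have hm := h5 p
  have := p.take_spec hm
  have h6 : (p.takeUntil x hm).reverse.support.tail.head? = some t := by
    cases hq : (p.takeUntil x hm).reverse with
    | nil => exact absurd rfl h2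
    | cons a q => obtain rfl := h _ a; cases q <;> simp
  have h7 : (p.dropUntil x hm).support.tail.head? = some t := by
    cases hq : (p.dropUntil x hm) with
    | nil => exact absurd rfl h3
    | cons a q => obtain rfl := h _ a; cases q <;> simp
  have hA : t ∈ (p.takeUntil x hm).support := by
    have := List.mem_of_mem_tail (List.mem_of_mem_head? h6)
    simpa using this
  have hB : t ∈ (p.dropUntil x hm).support.tail := List.mem_of_mem_head? h7
  rw [← p.take_spec hm, Walk.isPath_def, Walk.support_append, List.nodup_append] at hp
  exact hp.2.2 _ hA _ hB rfl

theorem card_essential_add_one_le (hyz : y ≠ z) (hr : G.Reachable y z) :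
    (essential n G y z).card + 1 ≤ G.dist y z := by
  classical
  obtain ⟨p, hp⟩ := hr.exists_walk_length_eq_dist
  have h1 : insert y (insert z (essential n G y z)) ⊆ p.support.toFinset := by
    intro w hw
    simp only [Finset.mem_insert] at hw
    rcases hw with rfl | rfl | hw
    · simp
    · simp
    · simpa using (mem_essential.1 hw).2.2.2.2 p
  have h2 := (Finset.card_le_card h1).trans (List.toFinset_card_le _)
  have hz : z ∉ essential n G y z := fun h => (mem_essential.1 h).2.2.1 rfl
  have hy : y ∉ insert z (essential n G y z) := by
    simp only [Finset.mem_insert, hyz, false_or]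
    exact fun h => (mem_essential.1 h).2.1 rfl
  rw [Finset.card_insert_of_notMem hy, Finset.card_insert_of_notMem hz, Walk.length_support,
    hp] at h2
  omega

theorem deleteLink_le : deleteLink G i j ≤ G := sdiff_le

theorem le_addLink : G ≤ addLink G i j := le_sup_left

theorem deleteLink_adj :
    (deleteLink G i j).Adj y z ↔ G.Adj y z ∧ ¬(y = i ∧ z = j) ∧ ¬(y = j ∧ z = i) := by
  simp only [deleteLink, SimpleGraph.sdiff_adj, SimpleGraph.edge_adj]
  constructor
  · rintro ⟨h, h'⟩; have := h.ne; tauto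
  · tauto

theorem addLink_adj :
    (addLink G i j).Adj y z ↔ G.Adj y z ∨ (((y = i ∧ z = j) ∨ (y = j ∧ z = i)) ∧ y ≠ z) := by
  simp only [addLink, SimpleGraph.sup_adj, SimpleGraph.edge_adj]

theorem addLink_comm : addLink G i j = addLink G j i := by
  rw [addLink, SimpleGraph.edge_comm, addLink]

theorem deleteLink_addLink (h : ¬ G.Adj i j) : deleteLink (addLink G i j) i j = G := by
  ext y z
  have h' : ¬ G.Adj j i := fun a => h a.symm
  rw [deleteLink_adj, addLink_adj]
  constructor
  · tauto
  · intro a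
    refine ⟨Or.inl a, ?_, ?_⟩ <;> rintro ⟨rfl, rfl⟩ <;> contradiction

theorem mem_essential_of_deleteLink (h : i ∈ essential n (deleteLink G i j) y z) :
    i ∈ essential n G y z := by
  rw [mem_essential] at h ⊢
  obtain ⟨h1, h2, h3, h4, h5⟩ := h
  refine ⟨h1, h2, h3, h4.mono deleteLink_le, fun p => ?_⟩
  by_contra hp
  have he : ∀ e ∈ p.edges, e ∈ (deleteLink G i j).edgeSet := by
    intro e
    induction e with | _ a b
    intro hab
    rw [SimpleGraph.mem_edgeSet, deleteLink_adj]
    refine ⟨p.adj_of_mem_edges hab, ?_, ?_⟩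
    · rintro ⟨rfl, rfl⟩; exact hp (p.fst_mem_support_of_mem_edges hab)
    · rintro ⟨rfl, rfl⟩; exact hp (p.snd_mem_support_of_mem_edges hab)
  have := h5 (p.transfer _ he)
  simp [hp] at this

theorem two_le_dist (hr : G.Reachable y z) (hne : y ≠ z) (h : ¬ G.Adj y z) : 2 ≤ G.dist y z := by
  have h1 : G.dist y z ≠ 0 := fun h0 => hne (hr.dist_eq_zero_iff.1 h0)
  have h2 : G.dist y z ≠ 1 := fun h1 => h (SimpleGraph.dist_eq_one_iff_adj.1 h1)
  omega

theorem three_le_dist (hr : G.Reachable y z) (hne : y ≠ z) (h : ¬ G.Adj y z)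
    (hc : ∀ m, G.Adj y m → ¬ G.Adj m z) : 3 ≤ G.dist y z := by
  have h1 := two_le_dist hr hne h
  have h2 : G.dist y z ≠ 2 := by
    intro h2
    obtain ⟨p, hp⟩ := hr.exists_walk_length_eq_dist
    rw [h2] at hp
    cases p with
    | nil => simp at hp
    | cons a q =>
      cases q with
      | nil => simp at hp
      | cons a' q' =>
        cases q' with
        | nil => exact hc _ a a'
        | cons _ _ => simp at hp
  omega

theorem dist_eq_two {m : ℕ} (hne : y ≠ z) (h : ¬ G.Adj y z) (ha : G.Adj y m) (hb : G.Adj m z) :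
    G.dist y z = 2 := by
  have h1 := two_le_dist (ha.reachable.trans hb.reachable) hne h
  have h2 := SimpleGraph.dist_le (.cons ha hb.toWalk)
  simp at h2
  omega

theorem dist_eq_three {m l : ℕ} (hne : y ≠ z) (h : ¬ G.Adj y z)
    (hc : ∀ m, G.Adj y m → ¬ G.Adj m z) (ha : G.Adj y m) (hb : G.Adj m l) (hd : G.Adj l z) :
    G.dist y z = 3 := by
  have h1 := three_le_dist ((ha.reachable.trans hb.reachable).trans hd.reachable) hne h hc
  have h2 := SimpleGraph.dist_le (.cons ha (.cons hb hd.toWalk))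
  simp at h2
  omega

end Graph

/-- The standing assumptions on the parameters. -/
structure Admissible (P : Params) : Prop where
  nonneg : ∀ i, 1 ≤ i → 0 ≤ P.b i
  anti : ∀ i, 1 ≤ i → P.b (i + 1) < P.b i
  γ_nonneg : 0 ≤ P.γ
  γ_lt : P.γ < (P.b 2 - P.b 3) / (3 * P.b 2 - P.b 3)
  lt_c : P.b 1 - P.b 2 + P.γ * (3 * P.b 2 - P.b 3) < P.c
  c_lt : P.c < P.b 1 - P.b 3
  lt_c₀ : (1 - P.γ) * (P.b 2 - P.b 3) < P.c₀
  c₀_le : P.c₀ ≤ (1 - P.γ) * P.b 2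

namespace Admissible

variable {P : Params} (hP : Admissible P)
include hP

theorem b_le {k l : ℕ} (hk : 1 ≤ k) (h : k ≤ l) : P.b l ≤ P.b k := by
  induction l, h using Nat.le_induction with
  | base => exact le_rfl
  | succ m hm ih => exact (hP.anti m (hk.trans hm)).le.trans ih

theorem γ_le_one : P.γ ≤ 1 := by
  have h2 := hP.anti 2 (by norm_num)
  have h3 := hP.nonneg 3 (by norm_num)
  norm_num at h2
  refine hP.γ_lt.le.trans ?_
  rw [div_le_one (by linarith)]
  linarith

theorem c_lt_b_one : P.c < P.b 1 := by
  have h3 := hP.nonneg 3 (by norm_num)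
  linarith [hP.c_lt]

end Admissible

section Utility

variable {P : Params} {n : ℕ} {G : SimpleGraph ℕ} {i j : ℕ}

open scoped Classical in
/-- What node `i` gets from node `w`, net of link costs and intermediation rents. -/
noncomputable def nodeValue (P : Params) (n : ℕ) (G : SimpleGraph ℕ) (i w : ℕ) : ℝ :=
  (if G.Adj i w then P.b 1 - P.c else 0) + (if 1 < G.dist i w then P.b (G.dist i w) else 0)
    - (if (essential n G i w).Nonempty then P.γ * P.b (G.dist i w) else 0)

open scoped Classical in
/-- What node `i` gets for connecting `y` and `z`, where `y < z`. -/
noncomputable def bridgeValue (P : Params) (n : ℕ) (G : SimpleGraph ℕ) (i y z : ℕ) : ℝ :=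
  if y < z ∧ i ∈ essential n G y z then
    P.γ / ((essential n G y z).card : ℝ) * (2 * P.b (G.dist y z)) else 0

theorem utility_eq_sum : utility P n G i =
    ∑ w ∈ Finset.range n, nodeValue P n G i w
      + ∑ y ∈ Finset.range n, ∑ z ∈ Finset.range n, bridgeValue P n G i y z := by
  classical
  simp only [utility, nodeValue, bridgeValue, degree, Finset.sum_sub_distrib,
    Finset.sum_add_distrib, Finset.sum_filter]
  congr 1
  congr 1
  congr 1
  rw [Finset.card_filter, Nat.cast_sum, Finset.sum_mul]
  refine Finset.sum_congr rfl fun w _ => ?_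
  split_ifs <;> simp

theorem nodeValue_of_adj {w : ℕ} (h : G.Adj i w) : nodeValue P n G i w = P.b 1 - P.c := by
  simp [nodeValue, h, essential_eq_empty_of_adj h, SimpleGraph.dist_eq_one_iff_adj.2 h]

theorem nodeValue_of_dist_eq_zero {w : ℕ} (h : G.dist i w = 0) : nodeValue P n G i w = 0 := by
  have h' : ¬ G.Adj i w := fun a => by simp [SimpleGraph.dist_eq_one_iff_adj.2 a] at h
  simp [nodeValue, h', essential_eq_empty_of_dist h, h]

theorem nodeValue_of_two_le {w : ℕ} (h : 2 ≤ G.dist i w)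
    (he : ¬ (essential n G i w).Nonempty) : nodeValue P n G i w = P.b (G.dist i w) := by
  have h' : ¬ G.Adj i w := fun a => by simp [SimpleGraph.dist_eq_one_iff_adj.2 a] at h
  have h1 : 1 < G.dist i w := h
  simp only [nodeValue, h', h1, he, if_true, if_false]
  ring

theorem nodeValue_of_nonempty {w : ℕ} (h : 2 ≤ G.dist i w)
    (he : (essential n G i w).Nonempty) :
    nodeValue P n G i w = (1 - P.γ) * P.b (G.dist i w) := by
  have h' : ¬ G.Adj i w := fun a => by simp [SimpleGraph.dist_eq_one_iff_adj.2 a] at h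
  have h1 : 1 < G.dist i w := h
  simp only [nodeValue, h', h1, he, if_true, if_false]
  ring

theorem bridgeValue_nonneg (hP : Admissible P) {y z : ℕ} : 0 ≤ bridgeValue P n G i y z := by
  unfold bridgeValue
  split_ifs with h
  · have h1 : 1 ≤ G.dist y z := by
      by_contra h0
      rw [essential_eq_empty_of_dist (by omega)] at h
      simp at h
    have := hP.nonneg _ h1
    have := hP.γ_nonneg
    positivity
  · exact le_rfl

theorem nodeValue_le (hP : Admissible P) {w : ℕ} (h : 2 ≤ G.dist i w) :
    nodeValue P n G i w ≤ P.b (G.dist i w) := by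
  by_cases he : (essential n G i w).Nonempty
  · rw [nodeValue_of_nonempty h he]
    nlinarith [hP.γ_nonneg, hP.nonneg (G.dist i w) (by omega)]
  · rw [nodeValue_of_two_le h he]

theorem le_nodeValue (hP : Admissible P) {w : ℕ} (h : 2 ≤ G.dist i w) :
    (1 - P.γ) * P.b (G.dist i w) ≤ nodeValue P n G i w := by
  by_cases he : (essential n G i w).Nonempty
  · rw [nodeValue_of_nonempty h he]
  · rw [nodeValue_of_two_le h he]
    nlinarith [hP.γ_nonneg, hP.nonneg (G.dist i w) (by omega)]

theorem nodeValue_nonneg (hP : Admissible P) {w : ℕ} : 0 ≤ nodeValue P n G i w := by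
  have hc := hP.c_lt_b_one
  rcases Nat.lt_or_ge (G.dist i w) 2 with h | h
  · interval_cases hd : G.dist i w
    · rw [nodeValue_of_dist_eq_zero hd]
    · rw [nodeValue_of_adj (SimpleGraph.dist_eq_one_iff_adj.1 hd)]
      linarith
  · refine le_trans ?_ (le_nodeValue hP h)
    exact mul_nonneg (by linarith [hP.γ_le_one]) (hP.nonneg _ (by omega))

theorem nodeValue_deleteLink_le (hP : Admissible P) {w : ℕ} (hw : w ≠ j) :
    nodeValue P n (deleteLink G i j) i w ≤ nodeValue P n G i w := by
  rcases Nat.lt_or_ge ((deleteLink G i j).dist i w) 2 with h | h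
  · interval_cases hd : (deleteLink G i j).dist i w
    · rw [nodeValue_of_dist_eq_zero hd]
      exact nodeValue_nonneg hP
    · have ha := SimpleGraph.dist_eq_one_iff_adj.1 hd
      rw [nodeValue_of_adj ha, nodeValue_of_adj (deleteLink_le ha)]
  · have hr : (deleteLink G i j).Reachable i w :=
      SimpleGraph.Reachable.of_dist_ne_zero (by omega)
    have hne : i ≠ w := by rintro rfl; simp at h
    have hna : ¬ G.Adj i w := by
      intro ha
      have : (deleteLink G i j).Adj i w := by
        rw [deleteLink_adj]
        refine ⟨ha, fun h => hw h.2, fun h => ha.ne h.2.symm⟩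
      rw [SimpleGraph.dist_eq_one_iff_adj.2 this] at h
      omega
    have hd := two_le_dist (hr.mono deleteLink_le) hne hna
    have hle : G.dist i w ≤ (deleteLink G i j).dist i w := by
      obtain ⟨p, hp⟩ := hr.exists_walk_length_eq_dist
      have := SimpleGraph.dist_le (p.mapLe deleteLink_le)
      rw [SimpleGraph.Walk.mapLe, SimpleGraph.Walk.length_map] at this
      omega
    have hb := hP.b_le (by omega : 1 ≤ G.dist i w) hle
    by_cases he : (essential n G i w).Nonempty
    · rw [nodeValue_of_nonempty hd he, nodeValue_of_nonempty h
        (he.mono (essential_subset_of_le deleteLink_le hr))]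
      exact mul_le_mul_of_nonneg_left hb (by linarith [hP.γ_le_one])
    · rw [nodeValue_of_two_le hd he]
      exact (nodeValue_le hP h).trans hb

theorem bridgeValue_deleteLink_le (hP : Admissible P) {y z : ℕ} :
    bridgeValue P n (deleteLink G i j) i y z ≤ bridgeValue P n G i y z := by
  by_cases h : y < z ∧ i ∈ essential n (deleteLink G i j) y z
  · have h' := mem_essential_of_deleteLink h.2
    have hr := (mem_essential.1 h.2).2.2.2.1
    have hle : G.dist y z ≤ (deleteLink G i j).dist y z := by
      obtain ⟨p, hp⟩ := hr.exists_walk_length_eq_dist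
      have := SimpleGraph.dist_le (p.mapLe deleteLink_le)
      rw [SimpleGraph.Walk.mapLe, SimpleGraph.Walk.length_map] at this
      omega
    have h1 : 1 ≤ G.dist y z := by
      by_contra h0
      rw [essential_eq_empty_of_dist (by omega)] at h'
      simp at h'
    have hc : 0 < (essential n G y z).card := Finset.card_pos.2 ⟨_, h'⟩
    rw [bridgeValue, bridgeValue, if_pos h, if_pos ⟨h.1, h'⟩]
    have := hP.γ_nonneg
    have := hP.nonneg _ (h1.trans hle)
    have := hP.b_le h1 hle
    have := Finset.card_le_card (essential_subset_of_le (n := n) (deleteLink_le) hr)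
    gcongr
  · rw [bridgeValue, if_neg h]
    exact bridgeValue_nonneg hP

/-- A node loses by deleting a link with a node with which it has no common neighbour. -/
theorem utility_deleteLink_lt (hP : Admissible P) (hj : j < n) (ha : G.Adj i j)
    (hc : ∀ m, G.Adj i m → ¬ G.Adj m j) :
    utility P n (deleteLink G i j) i < utility P n G i := by
  rw [utility_eq_sum, utility_eq_sum]
  refine add_lt_add_of_lt_of_le ?_ (Finset.sum_le_sum fun y _ => Finset.sum_le_sum fun z _ =>
    bridgeValue_deleteLink_le hP)
  have key : nodeValue P n (deleteLink G i j) i j < nodeValue P n G i j := by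
    have hcb := hP.c_lt_b_one
    rw [nodeValue_of_adj ha]
    by_cases h0 : (deleteLink G i j).dist i j = 0
    · rw [nodeValue_of_dist_eq_zero h0]
      linarith
    · have h3 := three_le_dist (SimpleGraph.Reachable.of_dist_ne_zero h0) ha.ne
        (by simp [deleteLink_adj])
        (fun m h1 h2 => hc m (deleteLink_le h1) (deleteLink_le h2))
      have h4 := nodeValue_le (n := n) hP (by omega : 2 ≤ (deleteLink G i j).dist i j)
      have h5 := hP.b_le (by norm_num) h3
      linarith [hP.c_lt]
  refine Finset.sum_lt_sum (fun w _ => ?_) ⟨j, Finset.mem_range.2 hj, key⟩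
  by_cases hw : w = j
  · exact hw ▸ key.le
  · exact nodeValue_deleteLink_le hP hw

theorem utility_lt_addLink (hP : Admissible P) (hj : j < n) (hij : i ≠ j) (ha : ¬ G.Adj i j)
    (hc : ∀ m, G.Adj i m → ¬ G.Adj m j) :
    utility P n G i < utility P n (addLink G i j) i := by
  have h := utility_deleteLink_lt (G := addLink G i j) (i := i) hP hj (by simp [addLink_adj, hij])
    (fun m h1 h2 => by
      rw [addLink_adj] at h1 h2
      rcases h1 with h1 | h1 <;> rcases h2 with h2 | h2
      · exact hc m h1 h2
      · have := h1.ne; have := h2.2; omega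
      · have := h2.ne; have := h1.2; omega
      · have := h2.2; have := h1.2; omega)
  rwa [deleteLink_addLink ha] at h

theorem bridgeValue_addLink_le (hP : Admissible P) {y z a b : ℕ} (hr : G.Reachable y z)
    (h2 : i ∈ essential n (addLink G i j) y z →
      ((addLink G i j).dist y z = G.dist y z ∧ essential n G y z ⊆ {i}) ∨
        (((y = a ∧ z = b) ∨ (y = b ∧ z = a)) ∧ G.dist y z ≤ 3)) :
    bridgeValue P n (addLink G i j) i y z ≤ bridgeValue P n G i y z +
      (if min a b = y then if max a b = z then P.γ * (2 * P.b 2 - P.b 3) else 0 else 0) := by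
  have hb2 := hP.b_le (show 1 ≤ 2 by norm_num) (show 2 ≤ 3 by norm_num)
  have hb3 := hP.nonneg 3 (by norm_num)
  have hγ := hP.γ_nonneg
  have hδ : 0 ≤ P.γ * (2 * P.b 2 - P.b 3) := mul_nonneg hγ (by linarith)
  have hite : 0 ≤ (if min a b = y then if max a b = z then P.γ * (2 * P.b 2 - P.b 3) else 0
      else 0) := by split_ifs <;> first | exact hδ | exact le_rfl
  by_cases h : y < z ∧ i ∈ essential n (addLink G i j) y z
  · have hsub := essential_subset_of_le (n := n) (le_addLink (i := i) (j := j)) hr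
    have h' := hsub h.2
    rcases h2 h.2 with ⟨hd, he⟩ | ⟨hab, hd⟩
    · have hE : essential n (addLink G i j) y z = essential n G y z := by
        refine hsub.antisymm (he.trans ?_)
        simpa using h.2
      have : bridgeValue P n (addLink G i j) i y z = bridgeValue P n G i y z := by
        simp only [bridgeValue, hE, hd]
      linarith
    · have e1 : min a b = y := by omega
      have e2 : max a b = z := by omega
      rw [if_pos e1, if_pos e2, bridgeValue, bridgeValue, if_pos h, if_pos ⟨h.1, h'⟩]
      have hr' := hr.mono (le_addLink (i := i) (j := j))
      have hc' : 1 ≤ (essential n (addLink G i j) y z).card := Finset.card_pos.2 ⟨_, h.2⟩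
      have hcard := card_essential_add_one_le (n := n) h.1.ne hr
      have hc : 1 ≤ (essential n G y z).card := Finset.card_pos.2 ⟨_, h'⟩
      have hd' : 2 ≤ (addLink G i j).dist y z := two_le_dist hr' h.1.ne
        fun a => notMem_essential_of_adj a h.2
      have hc2 : (essential n G y z).card ≤ 2 := by omega
      have b1 := hP.b_le (by norm_num) hd'
      have b2 := hP.b_le (by omega : 1 ≤ G.dist y z) hd
      have b0 := hP.nonneg _ (by omega : 1 ≤ (addLink G i j).dist y z)
      have i1 : P.γ / ((essential n (addLink G i j) y z).card : ℝ) ≤ P.γ :=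
        div_le_self hγ (by exact_mod_cast hc')
      have i2 : P.γ / 2 ≤ P.γ / ((essential n G y z).card : ℝ) := by
        have : ((essential n G y z).card : ℝ) ≤ 2 := by exact_mod_cast hc2
        have : (0 : ℝ) < ((essential n G y z).card : ℝ) := by exact_mod_cast hc
        gcongr
      have j1 : P.γ / ((essential n (addLink G i j) y z).card : ℝ) *
          (2 * P.b ((addLink G i j).dist y z)) ≤ P.γ * (2 * P.b 2) :=
        mul_le_mul i1 (by linarith) (by linarith) hγ
      have j2 : P.γ / 2 * (2 * P.b 3) ≤
          P.γ / ((essential n G y z).card : ℝ) * (2 * P.b (G.dist y z)) :=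
        mul_le_mul i2 (by linarith) (by linarith) (by positivity)
      linarith
  · rw [bridgeValue, if_neg h]
    exact add_nonneg (bridgeValue_nonneg hP) hite

/-- A node loses by a link with a node at distance two if its distances from other nodes do not
change, it does not save any other rents, and its position as an intermediary improves for at most
one pair of nodes. -/
theorem utility_addLink_lt (hP : Admissible P) (hj : j < n) (hij : i ≠ j)
    (hconn : ∀ y < n, ∀ z < n, G.Reachable y z) (hd : G.dist i j = 2)
    (h1 : ∀ w < n, w ≠ i → w ≠ j → (addLink G i j).dist i w = G.dist i w ∧
      ((essential n G i w).Nonempty → (essential n (addLink G i j) i w).Nonempty)) (a b : ℕ)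
    (h2 : ∀ y < n, ∀ z < n, y ≠ z → i ∈ essential n (addLink G i j) y z →
      ((addLink G i j).dist y z = G.dist y z ∧ essential n G y z ⊆ {i}) ∨
        (((y = a ∧ z = b) ∨ (y = b ∧ z = a)) ∧ G.dist y z ≤ 3)) :
    utility P n (addLink G i j) i < utility P n G i := by
  have hb2 := hP.b_le (show 1 ≤ 2 by norm_num) (show 2 ≤ 3 by norm_num)
  have hb3 := hP.nonneg 3 (by norm_num)
  have hδ : 0 ≤ P.γ * (2 * P.b 2 - P.b 3) := mul_nonneg hP.γ_nonneg (by linarith)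
  have hB : ∑ y ∈ Finset.range n, ∑ z ∈ Finset.range n, bridgeValue P n (addLink G i j) i y z ≤
      ∑ y ∈ Finset.range n, ∑ z ∈ Finset.range n, bridgeValue P n G i y z
        + P.γ * (2 * P.b 2 - P.b 3) := by
    have : ∑ y ∈ Finset.range n, ∑ z ∈ Finset.range n,
        (if min a b = y then if max a b = z then P.γ * (2 * P.b 2 - P.b 3) else 0 else 0)
        ≤ P.γ * (2 * P.b 2 - P.b 3) := by
      have e : ∀ y ∈ Finset.range n, ∑ z ∈ Finset.range n,
        (if min a b = y then if max a b = z then P.γ * (2 * P.b 2 - P.b 3) else 0 else 0)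
        ≤ if min a b = y then P.γ * (2 * P.b 2 - P.b 3) else 0 := by
        intro y _
        by_cases hy : min a b = y
        · simp only [hy, if_true, Finset.sum_ite_eq]
          split_ifs <;> first | exact hδ | exact le_rfl
        · simp [hy]
      refine (Finset.sum_le_sum e).trans ?_
      rw [Finset.sum_ite_eq]
      split_ifs <;> first | exact hδ | exact le_rfl
    refine le_trans ?_ (add_le_add_right this _)
    simp only [← Finset.sum_add_distrib]
    refine Finset.sum_le_sum fun y hy => Finset.sum_le_sum fun z hz => ?_
    rw [Finset.mem_range] at hy hz
    exact bridgeValue_addLink_le hP (hconn y hy z hz) fun he =>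
      h2 y hy z hz (by rintro rfl; simp [essential_eq_empty_of_dist] at he) he
  have hN : ∑ w ∈ Finset.range n, nodeValue P n (addLink G i j) i w ≤
      ∑ w ∈ Finset.range n, (nodeValue P n G i w +
        if j = w then P.b 1 - P.c - (1 - P.γ) * P.b 2 else 0) := by
    refine Finset.sum_le_sum fun w hw => ?_
    rw [Finset.mem_range] at hw
    by_cases hjw : j = w
    · subst hjw
      have := le_nodeValue (n := n) hP hd.ge
      rw [hd] at this
      rw [nodeValue_of_adj (by simp [addLink_adj, hij]), if_pos rfl]
      linarith
    · rw [if_neg hjw, add_zero]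
      by_cases hwi : w = i
      · subst hwi
        rw [nodeValue_of_dist_eq_zero (by simp), nodeValue_of_dist_eq_zero (by simp)]
      · obtain ⟨h3, h4⟩ := h1 w hw hwi (Ne.symm hjw)
        rcases Nat.lt_or_ge (G.dist i w) 2 with h | h
        · interval_cases hd' : G.dist i w
          · rw [nodeValue_of_dist_eq_zero hd', nodeValue_of_dist_eq_zero h3]
          · rw [nodeValue_of_adj (SimpleGraph.dist_eq_one_iff_adj.1 hd'),
              nodeValue_of_adj (SimpleGraph.dist_eq_one_iff_adj.1 h3)]
        · by_cases he : (essential n G i w).Nonempty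
          · rw [nodeValue_of_nonempty h he, nodeValue_of_nonempty (h3 ▸ h) (h4 he), h3]
          · rw [nodeValue_of_two_le h he, ← h3]
            exact nodeValue_le hP (h3 ▸ h)
  rw [Finset.sum_add_distrib, Finset.sum_ite_eq, if_pos (Finset.mem_range.2 hj)] at hN
  rw [utility_eq_sum, utility_eq_sum]
  linarith [hP.lt_c]

end Utility

theorem joinTo_adj {G : SimpleGraph ℕ} {x v w : ℕ} {K : Finset ℕ} :
    (joinTo G x K).Adj v w ↔
      G.Adj v w ∨ (((v = x ∧ w ∈ K) ∨ (v ∈ K ∧ w = x)) ∧ v ≠ w) := by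
  simp only [joinTo, SimpleGraph.sup_adj, SimpleGraph.iSup_adj, SimpleGraph.edge_adj]
  constructor
  · rintro (h | ⟨s, hs, h, h'⟩)
    · exact Or.inl h
    · rcases h with ⟨rfl, rfl⟩ | ⟨rfl, rfl⟩ <;> simp [hs, h']
  · rintro (h | ⟨⟨rfl, h⟩ | ⟨h, rfl⟩, h'⟩)
    · exact Or.inl h
    · exact Or.inr ⟨w, h, by simp [h']⟩
    · exact Or.inr ⟨v, h, by simp [h']⟩

theorem joinTo_singleton {G : SimpleGraph ℕ} {x t : ℕ} : joinTo G x {t} = addLink G x t := by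
  simp [joinTo, addLink]

theorem addLink_joinTo {G : SimpleGraph ℕ} {x s : ℕ} {K : Finset ℕ} :
    addLink (joinTo G x K) x s = joinTo G x (insert s K) := by
  ext v w
  simp only [addLink_adj, joinTo_adj, Finset.mem_insert]
  tauto

/-- `H` arises from the complete bipartite network with sides `L` and `S` on the nodes `0, …, x - 1`
by links between `x` and the nodes of `K ⊆ L`. -/
structure IsGrowing (x : ℕ) (H : SimpleGraph ℕ) (L S K : Finset ℕ) : Prop where
  disj : ∀ v ∈ L, v ∉ S
  mem_or : ∀ v < x, v ∈ L ∨ v ∈ S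
  lt_of_left : ∀ v ∈ L, v < x
  lt_of_right : ∀ v ∈ S, v < x
  card_le : S.card ≤ L.card
  card_le_succ : L.card ≤ S.card + 1
  subset : ∀ v ∈ K, v ∈ L
  nonempty : ∃ t, t ∈ K
  adj : ∀ v w, H.Adj v w ↔
    (v ∈ L ∧ w ∈ S) ∨ (v ∈ S ∧ w ∈ L) ∨ (v = x ∧ w ∈ K) ∨ (v ∈ K ∧ w = x)

theorem IsTuranSides.isGrowing {x : ℕ} {G : SimpleGraph ℕ} {L S K : Finset ℕ}
    (h : IsTuranSides x G L S) (hK : K ⊆ L) (hne : K.Nonempty) :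
    IsGrowing x (joinTo G x K) L S K := by
  obtain ⟨h1, h2, h3, h4, h5⟩ := h
  have hL : ∀ v ∈ L, v < x := fun v hv =>
    Finset.mem_range.1 (h2 ▸ Finset.mem_union_left _ hv)
  refine ⟨fun v a b => Finset.disjoint_left.1 h1 a b, fun v hv => ?_, hL,
    fun v hv => Finset.mem_range.1 (h2 ▸ Finset.mem_union_right _ hv), h3, h4,
    fun v hv => hK hv, hne, fun v w => ?_⟩
  · rw [← Finset.mem_union, h2]
    exact Finset.mem_range.2 hv
  · rw [joinTo_adj, h5]
    constructor
    · tauto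
    · have a1 : v ∈ K → v ≠ x := fun a => (hL v (hK a)).ne
      have a2 : w ∈ K → x ≠ w := fun a => (hL w (hK a)).ne'
      rintro (a | a | ⟨rfl, a⟩ | ⟨a, rfl⟩)
      · tauto
      · tauto
      · exact Or.inr ⟨Or.inl ⟨rfl, a⟩, a2 a⟩
      · exact Or.inr ⟨Or.inr ⟨a, rfl⟩, a1 a⟩

namespace IsGrowing

variable {x : ℕ} {H : SimpleGraph ℕ} {L S K : Finset ℕ} (h : IsGrowing x H L S K)
include h

theorem notMem_left : x ∉ L := fun a => (h.lt_of_left x a).ne rfl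

theorem notMem_right : x ∉ S := fun a => (h.lt_of_right x a).ne rfl

theorem cases {w : ℕ} (hw : w < x + 1) : w ∈ L ∨ w ∈ S ∨ w = x := by
  rcases (Nat.lt_succ_iff_lt_or_eq.1 hw) with h' | h'
  · rcases h.mem_or w h' with a | a <;> simp [a]
  · simp [h']

theorem exists_right {a b : ℕ} (ha : a ∈ L) (hb : b ∈ L) (hab : a ≠ b) : ∃ s, s ∈ S := by
  have : 1 < L.card := Finset.one_lt_card.2 ⟨a, ha, b, hb, hab⟩
  exact Finset.card_pos.1 (by have := h.card_le_succ; omega)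

theorem exists_right_ne {a b c : ℕ} (ha : a ∈ L) (hb : b ∈ L) (hc : c ∈ L) (hab : a ≠ b)
    (hac : a ≠ c) (hbc : b ≠ c) (v : ℕ) : ∃ s ∈ S, s ≠ v := by
  have : 2 < L.card := Finset.two_lt_card.2 ⟨a, ha, b, hb, c, hc, hab, hac, hbc⟩
  exact Finset.exists_mem_ne (by have := h.card_le_succ; omega) v

theorem exists_left_ne {a b : ℕ} (ha : a ∈ S) (hb : b ∈ S) (hab : a ≠ b) (v : ℕ) :
    ∃ l ∈ L, l ≠ v := by
  have : 1 < S.card := Finset.one_lt_card.2 ⟨a, ha, b, hb, hab⟩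
  exact Finset.exists_mem_ne (by have := h.card_le; omega) v

theorem reachable {y z : ℕ} (hy : y < x + 1) (hz : z < x + 1) : H.Reachable y z := by
  obtain ⟨t, ht⟩ := h.nonempty
  have htL := h.subset t ht
  have key : ∀ w < x + 1, H.Reachable w t := by
    intro w hw
    rcases h.cases hw with a | a | rfl
    · by_cases e : w = t
      · rw [e]
      · obtain ⟨s, hs⟩ := h.exists_right a htL e
        have h1 : H.Adj w s := by rw [h.adj]; tauto
        have h2 : H.Adj s t := by rw [h.adj]; tauto
        exact h1.reachable.trans h2.reachable
    · have h1 : H.Adj w t := by rw [h.adj]; tauto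
      exact h1.reachable
    · have h1 : H.Adj w t := by rw [h.adj]; tauto
      exact h1.reachable
  exact (key y hy).trans (key z hz).symm

/-- A growing network has no triangles. -/
theorem not_adj_of_adj {i j : ℕ} (ha : H.Adj i j) (m : ℕ) (hm : H.Adj i m) : ¬ H.Adj m j := by
  have h1 := h.disj
  have h2 := h.subset
  have h3 := h.notMem_left
  have h4 := h.notMem_right
  intro hm'
  rw [h.adj] at ha hm hm'
  grind

theorem not_adj_of_notMem {s : ℕ} (hs : s ∈ L) (hs' : s ∉ K) (m : ℕ) (hm : H.Adj x m) :
    ¬ H.Adj m s := by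
  have h1 := h.disj
  have h2 := h.subset
  have h3 := h.notMem_left
  have h4 := h.notMem_right
  intro hm'
  rw [h.adj] at hm hm'
  grind

end IsGrowing

section Same

variable {n : ℕ} {G : SimpleGraph ℕ} {i j y z m l : ℕ}

theorem dist_addLink_of_adj (ha : G.Adj y z) : (addLink G i j).dist y z = G.dist y z := by
  rw [SimpleGraph.dist_eq_one_iff_adj.2 ha, SimpleGraph.dist_eq_one_iff_adj.2 (le_addLink ha)]

theorem dist_addLink_of_two (hne : y ≠ z) (hn : ¬ (addLink G i j).Adj y z) (ha : G.Adj y m)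
    (hb : G.Adj m z) : (addLink G i j).dist y z = G.dist y z := by
  rw [dist_eq_two hne hn (le_addLink ha) (le_addLink hb),
    dist_eq_two hne (fun a => hn (le_addLink a)) ha hb]

theorem dist_addLink_of_three (hne : y ≠ z) (hn : ¬ (addLink G i j).Adj y z)
    (hc : ∀ m, (addLink G i j).Adj y m → ¬ (addLink G i j).Adj m z) (ha : G.Adj y m)
    (hb : G.Adj m l) (hd : G.Adj l z) : (addLink G i j).dist y z = G.dist y z := by
  rw [dist_eq_three hne hn hc (le_addLink ha) (le_addLink hb) (le_addLink hd),
    dist_eq_three hne (fun a => hn (le_addLink a))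
      (fun m h1 h2 => hc m (le_addLink h1) (le_addLink h2)) ha hb hd]

end Same

namespace IsGrowing

variable {P : Params} {x : ℕ} {H : SimpleGraph ℕ} {L S K : Finset ℕ}

/-- A node of `S` loses by a link with `x`. -/
theorem utility_addLink_right_new (hP : Admissible P) (h : IsGrowing x H L S K) {i : ℕ}
    (hi : i ∈ S) : utility P (x + 1) (addLink H i x) i < utility P (x + 1) H i := by
  have A := h.adj
  have A' : ∀ v w, (addLink H i x).Adj v w ↔ _ := fun v w => addLink_adj
  have h1 := h.disj
  have h2 := h.subset
  have h3 := h.notMem_left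
  have h4 := h.notMem_right
  obtain ⟨t, ht⟩ := h.nonempty
  have htL := h2 t ht
  have hix : i ≠ x := by rintro rfl; contradiction
  obtain ⟨l₀, hl₀⟩ : ∃ l₀, ∀ l ∈ L, l ∉ K → l ≠ l₀ → ∃ s ∈ S, s ≠ i := by
    by_cases hex : ∃ l ∈ L, l ∉ K
    · obtain ⟨l₀, hl, hl'⟩ := hex
      refine ⟨l₀, fun l a b c => h.exists_right_ne a hl htL c ?_ ?_ i⟩ <;> grind
    · exact ⟨0, by grind⟩
  refine utility_addLink_lt hP (Nat.lt_succ_self x) hix (fun y hy z hz => h.reachable hy hz)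
    (dist_eq_two (m := t) hix (by grind) (by grind) (by grind)) ?_ x l₀ ?_
  · intro w hw hwi hwx
    rcases h.cases hw with a | a | a
    · have hiw : H.Adj i w := by grind
      exact ⟨dist_addLink_of_adj hiw, fun e => by simp [essential_eq_empty_of_adj hiw] at e⟩
    · refine ⟨dist_addLink_of_two (m := t) hwi.symm (by grind) (by grind) (by grind), ?_⟩
      rintro ⟨v, hv⟩
      obtain ⟨m, hm, hmv⟩ := h.exists_left_ne a hi hwi v
      exact absurd hv (notMem_essential_of_two (m := m) (by grind) (by grind) hmv.symm)
    · contradiction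
  · set Q : ℕ → ℕ → Prop := fun y z => i ∈ essential (x + 1) (addLink H i x) y z →
      ((addLink H i x).dist y z = H.dist y z ∧ essential (x + 1) H y z ⊆ {i}) ∨
        (((y = x ∧ z = l₀) ∨ (y = l₀ ∧ z = x)) ∧ H.dist y z ≤ 3)
    have hsymm : ∀ y z, Q y z → Q z y := by
      intro y z hyz hi
      rw [SimpleGraph.dist_comm, H.dist_comm, essential_comm (y := z)]
      rw [essential_comm] at hi
      have := hyz hi
      tauto
    have hmem : ∀ y < x + 1, ∀ z < x + 1, i ∈ essential (x + 1) (addLink H i x) y z →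
        i ∈ essential (x + 1) H y z := fun y hy z hz hi =>
      essential_subset_of_le le_addLink (h.reachable hy hz) hi
    have hadj : ∀ y z, (addLink H i x).Adj y z → Q y z := fun y z a b =>
      absurd b (notMem_essential_of_adj a)
    have hLL : ∀ y ∈ L, ∀ z ∈ L, y ≠ z → Q y z := by
      intro y hy z hz hyz _
      refine Or.inl ⟨dist_addLink_of_two (m := i) hyz (by grind) (by grind) (by grind), ?_⟩
      intro v hv
      by_contra hvi
      exact notMem_essential_of_two (m := i) (by grind) (by grind) (by simpa using hvi) hv
    have hSS : ∀ y ∈ S, ∀ z ∈ S, y ≠ z → Q y z := fun y hy z hz hyz hi' =>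
      absurd hi' (notMem_essential_of_two (m := t) (by grind) (by grind) (by grind))
    have hxS : ∀ z ∈ S, Q x z := fun z hz hi' =>
      absurd hi' (notMem_essential_of_two (m := t) (by grind) (by grind) (by grind))
    have hxL : ∀ z ∈ L, Q x z := by
      intro z hz hi'
      by_cases hzK : z ∈ K
      · exact hadj x z (by grind) hi'
      · by_cases hzl : z = l₀
        · refine Or.inr ⟨Or.inl ⟨rfl, hzl⟩, ?_⟩
          exact SimpleGraph.dist_le (.cons (by grind : H.Adj x t) (.cons (by grind : H.Adj t i)
            (.cons (by grind : H.Adj i z) .nil)))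
        · obtain ⟨s, hs, hsi⟩ := hl₀ z hz hzK hzl
          exact absurd hi' (notMem_essential_of_three (m := t) (l := s) (by grind) (by grind)
            (by grind) (by grind) hsi.symm)
    intro y hy z hz hyz
    change Q y z
    rcases h.cases hy with a | a | rfl <;> rcases h.cases hz with b | b | rfl
    · exact hLL y a z b hyz
    · exact hadj y z (by grind)
    · exact hsymm _ _ (hxL y a)
    · exact hadj y z (by grind)
    · exact hSS y a z b hyz
    · exact hsymm _ _ (hxS y a)
    · exact hxL z b
    · exact hxS z b
    · contradiction

/-- A node of `S` loses by a link with another node of `S`. -/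
theorem utility_addLink_right_right (hP : Admissible P) (h : IsGrowing x H L S K) {i j : ℕ}
    (hi : i ∈ S) (hj : j ∈ S) (hij : i ≠ j) :
    utility P (x + 1) (addLink H i j) i < utility P (x + 1) H i := by
  have A := h.adj
  have A' : ∀ v w, (addLink H i j).Adj v w ↔ _ := fun v w => addLink_adj
  have h1 := h.disj
  have h2 := h.subset
  have h3 := h.notMem_left
  have h4 := h.notMem_right
  obtain ⟨t, ht⟩ := h.nonempty
  have htL := h2 t ht
  have hix : i ≠ x := by rintro rfl; contradiction
  have hjx : j ≠ x := by rintro rfl; contradiction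
  refine utility_addLink_lt hP (by have := h.lt_of_right j hj; omega) hij
    (fun y hy z hz => h.reachable hy hz)
    (dist_eq_two (m := t) hij (by grind) (by grind) (by grind)) ?_ 0 0 ?_
  · intro w hw hwi hwj
    rcases h.cases hw with a | a | a
    · have hiw : H.Adj i w := by grind
      exact ⟨dist_addLink_of_adj hiw, fun e => by simp [essential_eq_empty_of_adj hiw] at e⟩
    · refine ⟨dist_addLink_of_two (m := t) hwi.symm (by grind) (by grind) (by grind), ?_⟩
      rintro ⟨v, hv⟩
      obtain ⟨m, hm, hmv⟩ := h.exists_left_ne a hi hwi v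
      exact absurd hv (notMem_essential_of_two (m := m) (by grind) (by grind) hmv.symm)
    · subst a
      refine ⟨dist_addLink_of_two (m := t) hwi.symm (by grind) (by grind) (by grind), ?_⟩
      rintro ⟨v, hv⟩
      refine ⟨t, ?_⟩
      have hvt : ∀ m ∈ K, v = m := fun m hm => by
        by_contra hvm
        exact notMem_essential_of_two (m := m) (by grind) (by grind) hvm hv
      rw [essential_comm]
      refine mem_essential_of_leaf (by have := h.lt_of_left t htL; omega)
        ((h.reachable hw (by have := h.lt_of_right i hi; omega)).mono le_addLink)
        (by grind) (by grind) hwi (by grind)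
  · have hadj : ∀ y z, (addLink H i j).Adj y z → i ∉ essential (x + 1) (addLink H i j) y z :=
      fun y z a => notMem_essential_of_adj a
    have hsymm : ∀ y z, i ∉ essential (x + 1) (addLink H i j) y z →
        i ∉ essential (x + 1) (addLink H i j) z y := fun y z a => by rwa [essential_comm]
    have hLL : ∀ y ∈ L, ∀ z ∈ L, i ∉ essential (x + 1) (addLink H i j) y z := fun y hy z hz =>
      notMem_essential_of_two (m := j) (by grind) (by grind) hij
    have hSS : ∀ y ∈ S, ∀ z ∈ S, i ∉ essential (x + 1) (addLink H i j) y z := fun y hy z hz =>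
      notMem_essential_of_two (m := t) (by grind) (by grind) (by grind)
    have hxS : ∀ z ∈ S, i ∉ essential (x + 1) (addLink H i j) x z := fun z hz =>
      notMem_essential_of_two (m := t) (by grind) (by grind) (by grind)
    have hxL : ∀ z ∈ L, i ∉ essential (x + 1) (addLink H i j) x z := fun z hz =>
      notMem_essential_of_three (m := t) (l := j) (by grind) (by grind) (by grind) (by grind) hij
    intro y hy z hz hyz hi'
    exfalso
    revert hi'
    change i ∉ _
    rcases h.cases hy with a | a | rfl <;> rcases h.cases hz with b | b | rfl
    · exact hLL y a z b
    · exact hadj y z (by grind)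
    · exact hsymm _ _ (hxL y a)
    · exact hadj y z (by grind)
    · exact hSS y a z b
    · exact hsymm _ _ (hxS y a)
    · exact hxL z b
    · exact hxS z b
    · contradiction

/-- A node `i` of `L` loses by a link with another node `j` of `L`, unless `x` is linked to `j` but
not to `i`. -/
theorem utility_addLink_left_left (hP : Admissible P) (h : IsGrowing x H L S K) {i j : ℕ}
    (hi : i ∈ L) (hj : j ∈ L) (hij : i ≠ j) (hK : i ∈ K ∨ j ∉ K) :
    utility P (x + 1) (addLink H i j) i < utility P (x + 1) H i := by
  have A := h.adj
  have A' : ∀ v w, (addLink H i j).Adj v w ↔ _ := fun v w => addLink_adj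
  have h1 := h.disj
  have h2 := h.subset
  have h3 := h.notMem_left
  have h4 := h.notMem_right
  obtain ⟨s, hs⟩ := h.exists_right hi hj hij
  have hix : i ≠ x := by rintro rfl; contradiction
  have hjx : j ≠ x := by rintro rfl; contradiction
  obtain ⟨t, ht⟩ := h.nonempty
  have htL := h2 t ht
  have htx : t ≠ x := by rintro rfl; contradiction
  have hil := h.lt_of_left i hi
  refine utility_addLink_lt hP (by have := h.lt_of_left j hj; omega) hij
    (fun y hy z hz => h.reachable hy hz)
    (dist_eq_two (m := s) hij (by grind) (by grind) (by grind)) ?_ x j ?_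
  · intro w hw hwi hwj
    rcases h.cases hw with a | a | a
    · refine ⟨dist_addLink_of_two (m := s) hwi.symm (by grind) (by grind) (by grind), ?_⟩
      rintro ⟨v, hv⟩
      obtain ⟨m, hm, hmv⟩ := h.exists_right_ne a hi hj hwi hwj hij v
      exact absurd hv (notMem_essential_of_two (m := m) (by grind) (by grind) hmv.symm)
    · have hiw : H.Adj i w := by grind
      exact ⟨dist_addLink_of_adj hiw, fun e => by simp [essential_eq_empty_of_adj hiw] at e⟩
    · subst a
      by_cases hiK : i ∈ K
      · have hiw : H.Adj i w := by grind
        exact ⟨dist_addLink_of_adj hiw, fun e => by simp [essential_eq_empty_of_adj hiw] at e⟩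
      · have hjK : j ∉ K := by tauto
        refine ⟨dist_addLink_of_three (m := s) (l := t) hwi.symm (by grind) (by grind) (by grind)
          (by grind) (by grind), ?_⟩
        rintro ⟨v, hv⟩
        refine ⟨t, ?_⟩
        have htj : t ≠ j := by grind
        have hti : t ≠ i := by grind
        obtain ⟨s', hs', hsv⟩ := h.exists_right_ne htL hi hj hti htj hij v
        have hvt : ∀ m ∈ K, v = m := fun m hm => by
          by_contra hvm
          exact notMem_essential_of_three (m := s') (l := m) (by grind) (by grind) (by grind)
            hsv.symm hvm hv
        rw [essential_comm]
        refine mem_essential_of_leaf (by have := h.lt_of_left t htL; omega)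
          ((h.reachable hw (by omega)).mono le_addLink) (by grind) (by grind) hwi (by grind)
  · set Q : ℕ → ℕ → Prop := fun y z => i ∈ essential (x + 1) (addLink H i j) y z →
      ((addLink H i j).dist y z = H.dist y z ∧ essential (x + 1) H y z ⊆ {i}) ∨
        (((y = x ∧ z = j) ∨ (y = j ∧ z = x)) ∧ H.dist y z ≤ 3)
    have hsymm : ∀ y z, Q y z → Q z y := by
      intro y z hyz hi
      rw [SimpleGraph.dist_comm, H.dist_comm, essential_comm (y := z)]
      rw [essential_comm] at hi
      have := hyz hi
      tauto
    have hadj : ∀ y z, (addLink H i j).Adj y z → Q y z := fun y z a b =>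
      absurd b (notMem_essential_of_adj a)
    have hLL : ∀ y ∈ L, ∀ z ∈ L, Q y z := fun y hy z hz hi' =>
      absurd hi' (notMem_essential_of_two (m := s) (by grind) (by grind) (by grind))
    have hSS : ∀ y ∈ S, ∀ z ∈ S, Q y z := fun y hy z hz hi' =>
      absurd hi' (notMem_essential_of_two (m := j) (by grind) (by grind) hij)
    have hxS : ∀ z ∈ S, Q x z := by
      intro z hz hi'
      have hKi : ∀ m ∈ K, i = m := fun m hm => by
        by_contra him
        exact notMem_essential_of_two (m := m) (by grind) (by grind) him hi'
      have hiK : i ∈ K := by grind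
      refine Or.inl ⟨dist_addLink_of_two (m := i) (by grind) (by grind) (by grind) (by grind), ?_⟩
      intro v hv
      by_contra hvi
      exact notMem_essential_of_two (m := i) (by grind) (by grind) (by simpa using hvi) hv
    have hxL : ∀ z ∈ L, z ≠ i → Q x z := by
      intro z hz hzi hi'
      have hKi : ∀ m ∈ K, i = m := fun m hm => by
        by_contra him
        exact notMem_essential_of_three (m := m) (l := s) (by grind) (by grind) (by grind) him
          (by grind) hi'
      have hiK : i ∈ K := by grind
      by_cases hzj : z = j
      · refine Or.inr ⟨Or.inl ⟨rfl, hzj⟩, ?_⟩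
        exact SimpleGraph.dist_le (.cons (by grind : H.Adj x i) (.cons (by grind : H.Adj i s)
          (.cons (by grind : H.Adj s z) .nil)))
      · refine Or.inl ⟨dist_addLink_of_three (m := i) (l := s) (by grind) (by grind) (by grind)
          (by grind) (by grind) (by grind), ?_⟩
        intro v hv
        by_contra hvi
        obtain ⟨s', hs', hsv⟩ := h.exists_right_ne hz hi hj hzi hzj hij v
        exact notMem_essential_of_three (m := i) (l := s') (by grind) (by grind) (by grind)
          (by simpa using hvi) hsv.symm hv
    intro y hy z hz hyz hi'
    have hyi : y ≠ i := (mem_essential.1 hi').2.1.symm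
    have hzi : z ≠ i := (mem_essential.1 hi').2.2.1.symm
    revert hi'
    change Q y z
    rcases h.cases hy with a | a | rfl <;> rcases h.cases hz with b | b | rfl
    · exact hLL y a z b
    · exact hadj y z (by grind)
    · exact hsymm _ _ (hxL y a hyi)
    · exact hadj y z (by grind)
    · exact hSS y a z b
    · exact hsymm _ _ (hxS y a)
    · exact hxL z b hzi
    · exact hxS z b
    · contradiction

theorem insert_link (h : IsGrowing x H L S K) {s : ℕ} (hs : s ∈ L) :
    IsGrowing x (addLink H x s) L S (insert s K) := by
  have hsx := (h.lt_of_left s hs).ne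
  refine ⟨h.disj, h.mem_or, h.lt_of_left, h.lt_of_right, h.card_le, h.card_le_succ, ?_,
    ⟨s, by simp⟩, ?_⟩
  · intro v hv
    rcases Finset.mem_insert.1 hv with rfl | hv
    · exact hs
    · exact h.subset v hv
  · intro v w
    simp only [addLink_adj, h.adj, Finset.mem_insert]
    grind

theorem utility_lt_addLink_new (hP : Admissible P) (h : IsGrowing x H L S K) {s : ℕ} (hs : s ∈ L)
    (hs' : s ∉ K) :
    utility P (x + 1) H x < utility P (x + 1) (addLink H x s) x ∧
      utility P (x + 1) H s < utility P (x + 1) (addLink H x s) s := by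
  have hsx := h.lt_of_left s hs
  have hna : ¬ H.Adj x s := by
    have h3 := h.notMem_left
    have h4 := h.notMem_right
    rw [h.adj]
    grind
  have hc := h.not_adj_of_notMem hs hs'
  refine ⟨utility_lt_addLink hP (by omega) hsx.ne' hna hc, ?_⟩
  rw [addLink_comm]
  exact utility_lt_addLink hP (by omega) hsx.ne (fun a => hna a.symm)
    fun m h1 h2 => hc m h2.symm h1.symm

theorem utility_delete_lt (hP : Admissible P) (h : IsGrowing x H L S K) {i j : ℕ} (hj : j < x + 1)
    (ha : H.Adj i j) : utility P (x + 1) (deleteLink H i j) i < utility P (x + 1) H i :=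
  utility_deleteLink_lt hP hj ha (h.not_adj_of_adj ha)

/-- Of two unlinked nodes, one loses by a link between them, unless they are `x` and a node of
`L`. -/
theorem addLink_cases (hP : Admissible P) (h : IsGrowing x H L S K) {i j : ℕ} (hi : i < x + 1)
    (hj : j < x + 1) (hij : i ≠ j) (ha : ¬ H.Adj i j) :
    utility P (x + 1) (addLink H i j) i < utility P (x + 1) H i ∨
      utility P (x + 1) (addLink H i j) j < utility P (x + 1) H j ∨
        ∃ s ∈ L, s ∉ K ∧ ((i = x ∧ j = s) ∨ (i = s ∧ j = x)) := by
  rw [h.adj] at ha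
  rcases h.cases hi with a | a | a <;> rcases h.cases hj with b | b | b
  · by_cases hK : i ∈ K ∨ j ∉ K
    · exact Or.inl (h.utility_addLink_left_left hP a b hij hK)
    · right; left
      rw [addLink_comm]
      exact h.utility_addLink_left_left hP b a hij.symm (by tauto)
  · tauto
  · right; right; exact ⟨i, a, by tauto, by tauto⟩
  · tauto
  · exact Or.inl (h.utility_addLink_right_right hP a b hij)
  · subst b
    exact Or.inl (h.utility_addLink_right_new hP a)
  · right; right; exact ⟨j, b, by tauto, by tauto⟩
  · right; left
    subst a
    rw [addLink_comm]
    exact h.utility_addLink_right_new hP b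
  · omega

theorem pairwiseStable_iff (hP : Admissible P) (h : IsGrowing x H L S K) :
    PairwiseStable P (x + 1) H ↔ K = L := by
  constructor
  · rintro ⟨-, h2⟩
    refine Finset.Subset.antisymm h.subset fun s hs => ?_
    by_contra hs'
    obtain ⟨g1, g2⟩ := h.utility_lt_addLink_new hP hs hs'
    have hsx := h.lt_of_left s hs
    have hna : ¬ H.Adj x s := by
      have h3 := h.notMem_left
      have h4 := h.notMem_right
      rw [h.adj]
      grind
    exact lt_asymm g2 (h2 x (by omega) s (by omega) hsx.ne' hna g1)
  · intro e
    refine ⟨fun i hi j hj ha => (h.utility_delete_lt hP hj ha).le, fun i hi j hj hij ha hlt => ?_⟩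
    rcases h.addLink_cases hP hi hj hij ha with a | a | ⟨s, a, a', -⟩
    · exact absurd hlt a.asymm
    · exact a
    · exact absurd (e ▸ a) a'

theorem bestResponse (hP : Admissible P) (h : IsGrowing x H L S K) {i : ℕ} (hi : i < x + 1)
    {H' : SimpleGraph ℕ} (hB : BestResponse P (x + 1) H i H') :
    H' = H ∨ ∃ s ∈ L, s ∉ K ∧ H' = addLink H x s := by
  obtain ⟨hA, -, hlt⟩ := hB
  rcases hlt with e | hlt
  · exact Or.inl e
  rcases hA with e | ⟨j, hj, hij, ha, rfl, hacc⟩ | ⟨j, hj, ha, rfl⟩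
  · exact Or.inl e
  · right
    rcases h.addLink_cases hP hi hj hij.symm ha with a | a | ⟨s, a, a', ⟨rfl, rfl⟩ | ⟨rfl, rfl⟩⟩
    · exact absurd hlt a.asymm
    · exact absurd hacc a.not_ge
    · exact ⟨j, a, a', rfl⟩
    · exact ⟨i, a, a', addLink_comm⟩
  · exact absurd hlt (h.utility_delete_lt hP hj ha).asymm

theorem available_new (hP : Admissible P) (h : IsGrowing x H L S K) {s : ℕ} (hs : s ∈ L)
    (hs' : s ∉ K) : Available P (x + 1) H x (addLink H x s) := by
  have hsx := h.lt_of_left s hs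
  refine Or.inr (Or.inl ⟨s, by omega, hsx.ne, ?_, rfl, (h.utility_lt_addLink_new hP hs hs').2.le⟩)
  have h3 := h.notMem_left
  have h4 := h.notMem_right
  rw [h.adj]
  grind

theorem not_bestResponse_self (hP : Admissible P) (h : IsGrowing x H L S K) {s : ℕ} (hs : s ∈ L)
    (hs' : s ∉ K) : ¬ BestResponse P (x + 1) H x H := fun hB =>
  (h.utility_lt_addLink_new hP hs hs').1.not_ge (hB.2.1 _ (h.available_new hP hs hs'))

end IsGrowing

theorem finite_available {P : Params} {n : ℕ} {G : SimpleGraph ℕ} {i : ℕ} :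
    {H | Available P n G i H}.Finite := by
  refine Set.Finite.subset ((Set.finite_singleton G).union
    (((Set.finite_lt_nat n).image (addLink G i)).union
      ((Set.finite_lt_nat n).image (deleteLink G i)))) ?_
  rintro H (rfl | ⟨j, hj, -, -, rfl, -⟩ | ⟨j, hj, -, rfl⟩)
  · exact Or.inl rfl
  · exact Or.inr (Or.inl ⟨j, hj, rfl⟩)
  · exact Or.inr (Or.inr ⟨j, hj, rfl⟩)

theorem exists_bestResponse {P : Params} {n : ℕ} {G : SimpleGraph ℕ} {i : ℕ} :
    ∃ H, BestResponse P n G i H := by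
  obtain ⟨H, hH, hmax⟩ := Set.exists_max_image _ (fun H => utility P n H i)
    (finite_available (P := P) (n := n) (G := G) (i := i)) ⟨G, Or.inl rfl⟩
  by_cases h : utility P n G i < utility P n H i
  · exact ⟨H, hH, hmax, Or.inr h⟩
  · exact ⟨G, Or.inl rfl, fun H' h' => (hmax H' h').trans (not_lt.1 h), Or.inl rfl⟩

namespace IsGrowing

variable {P : Params} {x : ℕ} {H : SimpleGraph ℕ} {L S K : Finset ℕ}

theorem exists_step (hP : Admissible P) (h : IsGrowing x H L S K) (hne : K ≠ L) :
    ∃ s ∈ L, s ∉ K ∧ Step P (x + 1) H (addLink H x s) := by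
  obtain ⟨s, hs, hs'⟩ : ∃ s ∈ L, s ∉ K := by
    by_contra! hc
    exact hne (Finset.Subset.antisymm h.subset hc)
  obtain ⟨H', hB⟩ := exists_bestResponse (P := P) (n := x + 1) (G := H) (i := x)
  rcases h.bestResponse hP (Nat.lt_succ_self x) hB with rfl | ⟨s', h1, h2, rfl⟩
  · exact absurd hB (h.not_bestResponse_self hP hs hs')
  · exact ⟨s', h1, h2, x, Nat.lt_succ_self x, hB⟩

theorem card_sdiff_insert {s : ℕ} (hs : s ∈ L) (hs' : s ∉ K) :
    (L \ insert s K).card < (L \ K).card := by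
  refine Finset.card_lt_card (Finset.ssubset_iff_subset_ne.2 ⟨fun v => ?_, fun e => ?_⟩)
  · simp only [Finset.mem_sdiff, Finset.mem_insert]
    tauto
  · have : s ∈ L \ insert s K := e ▸ Finset.mem_sdiff.2 ⟨hs, hs'⟩
    simp at this

theorem fairRun (hP : Admissible P) (h : IsGrowing x H L S K) {m : ℕ → ℕ} {g : ℕ → SimpleGraph ℕ}
    (hr : FairRun P (x + 1) H m g) :
    ∃ N, PairwiseStable P (x + 1) (g N) ∧ ∀ k ≥ N, g k = g N := by
  induction hd : (L \ K).card using Nat.strong_induction_on generalizing H K m g with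
  | _ d ih =>
  obtain ⟨h0, h1, h2⟩ := hr
  by_cases hall : ∀ k, g k = H
  · refine ⟨0, ?_, fun k _ => by rw [hall, hall]⟩
    rw [h0, h.pairwiseStable_iff hP]
    by_contra hne
    obtain ⟨s, hs, hs', -⟩ := h.exists_step hP hne
    obtain ⟨k, -, hk⟩ := h2 x (Nat.lt_succ_self x) 0
    have := (h1 k).2
    rw [hall, hall, hk] at this
    exact h.not_bestResponse_self hP hs hs' this
  · push Not at hall
    obtain ⟨k, hk, hk'⟩ : ∃ k, g k = H ∧ g (k + 1) ≠ H := by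
      by_contra! hc
      obtain ⟨k, hk⟩ := hall
      refine hk ?_
      clear hk
      induction k with
      | zero => exact h0
      | succ k ihk => exact hc k ihk
    have hB := h1 k
    rw [hk] at hB
    rcases h.bestResponse hP hB.1 hB.2 with e | ⟨s, hs, hs', e⟩
    · exact absurd e hk'
    · have hshift : FairRun P (x + 1) (addLink H x s) (fun l => m (k + 1 + l))
          (fun l => g (k + 1 + l)) := by
        refine ⟨e, fun l => h1 (k + 1 + l), fun i hi M => ?_⟩
        obtain ⟨l, hl, hl'⟩ := h2 i hi (k + 1 + M)
        refine ⟨l - (k + 1), by omega, ?_⟩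
        change m (k + 1 + (l - (k + 1))) = i
        rw [← hl', Nat.add_sub_cancel' (by omega)]
      obtain ⟨N, hN, hN'⟩ := ih _ (hd ▸ card_sdiff_insert hs hs') (h.insert_link hs) hshift rfl
      refine ⟨k + 1 + N, hN, fun l hl => ?_⟩
      have := hN' (l - (k + 1)) (by omega)
      rwa [show k + 1 + (l - (k + 1)) = l by omega] at this

theorem isTuranSides (h : IsGrowing x H L S L) :
    ∃ L' S', IsTuranSides (x + 1) H L' S' := by
  have h3 := h.notMem_left
  have h4 := h.notMem_right
  have hd : Disjoint L (insert x S) := by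
    rw [Finset.disjoint_left]
    intro v hv hv'
    rcases Finset.mem_insert.1 hv' with rfl | a
    · exact h3 hv
    · exact h.disj v hv a
  have hU : L ∪ insert x S = Finset.range (x + 1) := by
    ext v
    simp only [Finset.mem_union, Finset.mem_insert, Finset.mem_range]
    constructor
    · rintro (a | rfl | a)
      · have := h.lt_of_left v a; omega
      · omega
      · have := h.lt_of_right v a; omega
    · intro hv
      have := h.cases hv
      tauto
  have hc := Finset.card_insert_of_notMem h4
  have hA : ∀ v w, H.Adj v w ↔ (v ∈ L ∧ w ∈ insert x S) ∨ (v ∈ insert x S ∧ w ∈ L) := by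
    intro v w
    rw [h.adj]
    simp only [Finset.mem_insert]
    tauto
  have h1 := h.card_le
  have h2 := h.card_le_succ
  by_cases hlt : S.card < L.card
  · exact ⟨L, insert x S, hd, hU, by omega, by omega, hA⟩
  · refine ⟨insert x S, L, hd.symm, by rw [Finset.union_comm, hU], by omega, by omega, ?_⟩
    intro v w
    rw [hA, or_comm]

end IsGrowing

section Entry

variable {P : Params} {n : ℕ} {G : SimpleGraph ℕ}

theorem not_reachable_of_isolated {x w : ℕ} (h : ∀ v, ¬ G.Adj x v) (hw : x ≠ w) :
    ¬ G.Reachable x w := by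
  rintro ⟨p⟩
  cases p with
  | nil => exact hw rfl
  | cons a _ => exact h _ a

theorem utility_succ_of_isolated (h : ∀ v, ¬ G.Adj n v) (i : ℕ) :
    utility P (n + 1) G i = utility P n G i := by
  have hE : ∀ y z, essential (n + 1) G y z = essential n G y z := by
    intro y z
    ext v
    have hn : n ∉ essential (n + 1) G y z :=
      leaf_notMem_essential (t := 0) fun w a => absurd a (h w)
    constructor
    · intro hv
      have hvn : v ≠ n := by rintro rfl; exact hn hv
      rw [mem_essential] at hv ⊢
      exact ⟨by omega, hv.2⟩
    · intro hv
      rw [mem_essential] at hv ⊢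
      exact ⟨by omega, hv.2⟩
  have hd : ∀ w, G.dist n w = 0 := by
    intro w
    by_cases hw : n = w
    · simp [hw]
    · exact SimpleGraph.dist_eq_zero_of_not_reachable (not_reachable_of_isolated h hw)
  have hN : ∀ w, nodeValue P (n + 1) G i w = nodeValue P n G i w := fun w => by
    simp only [nodeValue, hE]
  have hB : ∀ y z, bridgeValue P (n + 1) G i y z = bridgeValue P n G i y z := fun y z => by
    simp only [bridgeValue, hE]
  have e1 : ∀ z, bridgeValue P n G i n z = 0 := fun z => by
    simp [bridgeValue, essential_eq_empty_of_dist (hd z)]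
  have e2 : ∀ y, bridgeValue P n G i y n = 0 := fun y => by
    simp [bridgeValue, essential_eq_empty_of_dist (G.dist_comm.trans (hd y))]
  have e3 : nodeValue P n G i n = 0 :=
    nodeValue_of_dist_eq_zero (G.dist_comm.trans (hd i))
  rw [utility_eq_sum, utility_eq_sum]
  simp only [hN, hB, Finset.sum_range_succ, e1, e2, e3, Finset.sum_const_zero, add_zero]

theorem acceptsEntry (hP : Admissible P) (h : ∀ v, ¬ G.Adj n v) {t : ℕ} (ht : t < n) :
    AcceptsEntry P n G t := by
  refine ⟨ht, ?_⟩
  rw [← utility_succ_of_isolated h, addLink_comm]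
  exact (utility_lt_addLink hP (by omega) ht.ne (fun a => h _ a.symm)
    fun m _ hm => h _ hm.symm).le

/-- The utility of a new node that enters a complete bipartite network with sides `A` and `B` by a
link with a node of `A`. -/
theorem entryUtility_eq {A B : Finset ℕ} (hd : Disjoint A B) (hU : A ∪ B = Finset.range n)
    (hA : ∀ v w, G.Adj v w ↔ (v ∈ A ∧ w ∈ B) ∨ (v ∈ B ∧ w ∈ A)) {t : ℕ} (ht : t ∈ A)
    (hne : ∀ w ∈ A, w ≠ t → B.Nonempty) :
    entryUtility P n G t = P.b 1 - P.c + (1 - P.γ) * (B.card * P.b 2 + (A.card - 1) * P.b 3)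
      - P.c₀ * B.card := by
  classical
  have hmem : ∀ v, v ∈ A ∨ v ∈ B ↔ v < n := fun v => by
    rw [← Finset.mem_union, hU, Finset.mem_range]
  have hdis : ∀ v ∈ A, v ∉ B := fun v a b => Finset.disjoint_left.1 hd a b
  have htn : t < n := (hmem t).1 (Or.inl ht)
  have hnA : n ∉ A := fun a => ((hmem n).1 (Or.inl a)).ne rfl
  have hnB : n ∉ B := fun a => ((hmem n).1 (Or.inr a)).ne rfl
  have hA' : ∀ v w, (addLink G n t).Adj v w ↔ _ := fun v w => addLink_adj
  have hleaf : ∀ w, (addLink G n t).Adj n w → w = t := by grind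
  have hdeg : degree n G t = B.card := by
    unfold degree
    congr 1
    ext w
    simp only [Finset.mem_filter, Finset.mem_range]
    grind
  have hnt : (addLink G n t).Adj n t := by grind
  have hE : ∀ w, w ≠ n → w ≠ t → (addLink G n t).Reachable n w →
      (essential (n + 1) (addLink G n t) n w).Nonempty := fun w h1 h2 hr =>
    ⟨t, mem_essential_of_leaf (by omega) hr (by omega) h2.symm h1.symm hleaf⟩
  have vB : ∀ w ∈ B, nodeValue P (n + 1) (addLink G n t) n w = (1 - P.γ) * P.b 2 := by
    intro w hw
    have htw : (addLink G n t).Adj t w := by grind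
    have h2 : (addLink G n t).dist n w = 2 := dist_eq_two (by grind) (by grind) hnt htw
    rw [nodeValue_of_nonempty h2.ge (hE w (by grind) (by grind)
      (hnt.reachable.trans htw.reachable)), h2]
  have vA : ∀ w ∈ A.erase t, nodeValue P (n + 1) (addLink G n t) n w = (1 - P.γ) * P.b 3 := by
    intro w hw
    obtain ⟨hwt, hw⟩ := Finset.mem_erase.1 hw
    obtain ⟨s, hs⟩ := hne w hw hwt
    have hts : (addLink G n t).Adj t s := by grind
    have hsw : (addLink G n t).Adj s w := by grind
    have h3 : (addLink G n t).dist n w = 3 :=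
      dist_eq_three (by grind) (by grind) (by grind) hnt hts hsw
    rw [nodeValue_of_nonempty (by omega) (hE w (by grind) (by grind)
      ((hnt.reachable.trans hts.reachable).trans hsw.reachable)), h3]
  have hB0 : ∀ y z, bridgeValue P (n + 1) (addLink G n t) n y z = 0 := fun y z => by
    simp [bridgeValue, leaf_notMem_essential hleaf]
  have hcA : ((A.erase t).card : ℝ) = A.card - 1 := by
    rw [Finset.card_erase_of_mem ht, Nat.cast_sub (Finset.card_pos.2 ⟨t, ht⟩), Nat.cast_one]
  rw [entryUtility, utility_eq_sum, hdeg, Finset.sum_range_succ, ← hU, Finset.sum_union hd,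
    ← Finset.add_sum_erase A _ ht, Finset.sum_congr rfl vA, Finset.sum_congr rfl vB,
    nodeValue_of_adj hnt, nodeValue_of_dist_eq_zero (w := n) (by simp)]
  simp only [hB0, Finset.sum_const, nsmul_eq_mul, hcA]
  ring

end Entry

namespace IsTuranSides

variable {P : Params} {n : ℕ} {G : SimpleGraph ℕ} {L S : Finset ℕ}

theorem symm (h : IsTuranSides n G L S) (hc : L.card = S.card) : IsTuranSides n G S L := by
  obtain ⟨h1, h2, h3, h4, h5⟩ := h
  refine ⟨h1.symm, by rw [Finset.union_comm, h2], by omega, by omega, fun v w => ?_⟩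
  rw [h5, or_comm]

theorem mem_or_iff (h : IsTuranSides n G L S) {v : ℕ} : v ∈ L ∨ v ∈ S ↔ v < n := by
  rw [← Finset.mem_union, h.2.1, Finset.mem_range]

theorem isolated (h : IsTuranSides n G L S) (v : ℕ) : ¬ G.Adj n v := by
  rw [h.2.2.2.2]
  have h1 : ¬ (n ∈ L ∨ n ∈ S) := by rw [h.mem_or_iff]; omega
  tauto

theorem acceptsEntry_iff (hP : Admissible P) (h : IsTuranSides n G L S) {t : ℕ} :
    AcceptsEntry P n G t ↔ t < n :=
  ⟨fun a => a.1, acceptsEntry hP h.isolated⟩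

theorem entryUtility_left (h : IsTuranSides n G L S) {t : ℕ} (ht : t ∈ L) :
    entryUtility P n G t = P.b 1 - P.c + (1 - P.γ) * (S.card * P.b 2 + (L.card - 1) * P.b 3)
      - P.c₀ * S.card := by
  refine entryUtility_eq h.1 h.2.1 h.2.2.2.2 ht fun w hw hwt => ?_
  have : 1 < L.card := Finset.one_lt_card.2 ⟨w, hw, t, ht, hwt⟩
  exact Finset.card_pos.1 (by have := h.2.2.2.1; omega)

theorem entryUtility_right (h : IsTuranSides n G L S) {t : ℕ} (ht : t ∈ S) :
    entryUtility P n G t = P.b 1 - P.c + (1 - P.γ) * (L.card * P.b 2 + (S.card - 1) * P.b 3)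
      - P.c₀ * L.card := by
  refine entryUtility_eq h.1.symm (by rw [Finset.union_comm, h.2.1])
    (fun v w => by rw [h.2.2.2.2, or_comm]) ht fun w hw hwt => ?_
  have : 0 < S.card := Finset.card_pos.2 ⟨t, ht⟩
  exact Finset.card_pos.1 (by have := h.2.2.1; omega)

theorem entryUtility_pos (hP : Admissible P) (h : IsTuranSides n G L S) {t : ℕ} (ht : t ∈ L) :
    0 < entryUtility P n G t := by
  rw [h.entryUtility_left ht]
  have h1 : (1 : ℝ) ≤ L.card := by exact_mod_cast Finset.card_pos.2 ⟨t, ht⟩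
  have h2 : (0 : ℝ) ≤ S.card := by positivity
  have h3 := mul_nonneg (sub_nonneg.2 h1) (hP.nonneg 3 (by norm_num))
  have h4 := mul_nonneg (sub_nonneg.2 hP.γ_le_one) h3
  have h5 := mul_le_mul_of_nonneg_right hP.c₀_le h2
  nlinarith [hP.c_lt_b_one]

theorem entryUtility_right_add (h : IsTuranSides n G L S) {s t : ℕ} (hs : s ∈ S) (ht : t ∈ L) :
    entryUtility P n G s + (L.card - S.card) * (P.c₀ - (1 - P.γ) * (P.b 2 - P.b 3)) =
      entryUtility P n G t := by
  rw [h.entryUtility_left ht, h.entryUtility_right hs]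
  ring

theorem exists_left (h : IsTuranSides n G L S) (hn : 1 ≤ n) : ∃ t, t ∈ L := by
  refine Finset.card_pos.1 ?_
  have := Finset.card_union_of_disjoint h.1
  rw [h.2.1, Finset.card_range] at this
  have := h.2.2.1
  omega

theorem exists_entryResponse (hP : Admissible P) (h : IsTuranSides n G L S) (hn : 1 ≤ n) :
    ∃ t, EntryResponse P n G t := by
  obtain ⟨t, ht⟩ := h.exists_left hn
  refine ⟨t, (h.acceptsEntry_iff hP).2 (h.mem_or_iff.1 (Or.inl ht)), h.entryUtility_pos hP ht,
    fun s hs => ?_⟩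
  rcases h.mem_or_iff.2 hs.1 with a | a
  · rw [h.entryUtility_left ht, h.entryUtility_left a]
  · rw [← h.entryUtility_right_add a ht]
    have : (S.card : ℝ) ≤ L.card := by exact_mod_cast h.2.2.1
    nlinarith [hP.lt_c₀]

theorem exists_of_entryResponse (hP : Admissible P) (h : IsTuranSides n G L S) {t : ℕ}
    (ht : EntryResponse P n G t) : ∃ L S, IsTuranSides n G L S ∧ t ∈ L := by
  rcases h.mem_or_iff.2 ht.1.1 with a | a
  · exact ⟨L, S, h, a⟩
  · refine ⟨S, L, h.symm ?_, a⟩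
    by_contra hne
    have hlt : S.card < L.card := by have := h.2.2.1; omega
    obtain ⟨l, hl⟩ : ∃ l, l ∈ L := Finset.card_pos.1 (by omega)
    have h1 := ht.2.2 l ((h.acceptsEntry_iff hP).2 (h.mem_or_iff.1 (Or.inl hl)))
    rw [← h.entryUtility_right_add a hl] at h1
    have : (S.card : ℝ) < L.card := by exact_mod_cast hlt
    have h2 := mul_pos (sub_pos.2 this) (sub_pos.2 hP.lt_c₀)
    linarith

theorem card_filter_even (n : ℕ) : ((Finset.range n).filter fun v => v % 2 = 0).card =
    (n + 1) / 2 := by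
  induction n with
  | zero => simp
  | succ n ih =>
    rw [Finset.range_add_one, Finset.filter_insert]
    split_ifs
    · rw [Finset.card_insert_of_notMem (by simp), ih]; omega
    · rw [ih]; omega

theorem isBipartiteTuran (h : IsTuranSides n G L S) : IsBipartiteTuran n G := by
  classical
  obtain ⟨h1, h2, h3, h4, h5⟩ := id h
  have hcard := Finset.card_union_of_disjoint h1
  rw [h2, Finset.card_range] at hcard
  have hL : ((Finset.range n).filter fun v => v ∈ L) = L := by
    ext v
    simp only [Finset.mem_filter, Finset.mem_range, and_iff_right_iff_imp]
    exact fun hv => h.mem_or_iff.1 (Or.inl hv)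
  have e1 : ∀ (p : ℕ → Prop) [DecidablePred p], Fintype.card {v : Fin n // p v} =
      ((Finset.range n).filter p).card := by
    intro p _
    rw [Fintype.card_subtype, ← Finset.card_map Fin.valEmbedding]
    congr 1
    ext v
    simp only [Finset.mem_map, Finset.mem_filter, Finset.mem_univ, true_and, Finset.mem_range,
      Fin.valEmbedding_apply]
    exact ⟨fun ⟨u, hu, e⟩ => e ▸ ⟨u.2, hu⟩, fun ⟨hv, hp⟩ => ⟨⟨v, hv⟩, hp, rfl⟩⟩
  have hcd : Fintype.card {v : Fin n // (v : ℕ) ∈ L} =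
      Fintype.card {v : Fin n // (v : ℕ) % 2 = 0} := by
    rw [e1 (· ∈ L), e1 (· % 2 = 0), card_filter_even, hL]
    omega
  let e := Fintype.equivOfCardEq hcd
  have hiff : ∀ v : Fin n, ((e.extendSubtype v : Fin n) : ℕ) % 2 = 0 ↔ (v : ℕ) ∈ L := by
    intro v
    by_cases hv : (v : ℕ) ∈ L
    · exact iff_of_true (e.extendSubtype_mem v hv) hv
    · exact iff_of_false (e.extendSubtype_not_mem v hv) hv
  refine ⟨⟨e.extendSubtype, fun {v w} => ?_⟩⟩
  rw [SimpleGraph.turanGraph_adj, SimpleGraph.comap_adj, h5]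
  have hv := hiff v
  have hw := hiff w
  have a1 : ∀ u : Fin n, (u : ℕ) ∈ S ↔ (u : ℕ) ∉ L := fun u => by
    have b1 := h.mem_or_iff.2 u.2
    have b2 : (u : ℕ) ∈ L → (u : ℕ) ∉ S := fun b => Finset.disjoint_left.1 h1 b
    tauto
  rw [a1, a1, ← hv, ← hw]
  omega

end IsTuranSides

section Dynamics

variable {P : Params} {n : ℕ} {G : SimpleGraph ℕ}

theorem isTuranSides_one : IsTuranSides 1 ⊥ {0} ∅ := by
  refine ⟨by simp, by simp, by simp, by simp, by simp⟩

theorem bestResponse_one {H : SimpleGraph ℕ} {i : ℕ} (hi : i < 1)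
    (h : BestResponse P 1 ⊥ i H) : H = ⊥ := by
  rcases h.1 with e | ⟨j, hj, hij, -⟩ | ⟨j, hj, ha, -⟩
  · exact e
  · omega
  · exact absurd ha (by simp)

theorem pairwiseStable_one : PairwiseStable P 1 ⊥ :=
  ⟨fun _ _ _ _ ha => absurd ha (by simp), fun i hi j hj hij => by omega⟩

theorem IsGrowing.exists_isTuranSides (hP : Admissible P) {x : ℕ} {L S K : Finset ℕ}
    (h : IsGrowing x G L S K) (hs : PairwiseStable P (x + 1) G) :
    ∃ L S, IsTuranSides (x + 1) G L S := by
  obtain rfl := (h.pairwiseStable_iff hP).1 hs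
  exact h.isTuranSides

theorem IsTuranSides.isGrowing_addLink {L S : Finset ℕ} (h : IsTuranSides n G L S) {t : ℕ}
    (ht : t ∈ L) : IsGrowing n (addLink G n t) L S {t} := by
  rw [← joinTo_singleton]
  exact h.isGrowing (by simpa using ht) (by simp)

theorem Arises.cases (hP : Admissible P) (h : Arises P n G) :
    (n = 1 ∧ G = ⊥) ∨ ∃ x L S K, n = x + 1 ∧ IsGrowing x G L S K := by
  induction h with
  | start => exact Or.inl ⟨rfl, rfl⟩
  | move _ hs ih =>
    obtain ⟨i, hi, hB⟩ := hs
    rcases ih with ⟨rfl, rfl⟩ | ⟨x, L, S, K, rfl, hg⟩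
    · exact Or.inl ⟨rfl, bestResponse_one hi hB⟩
    · right
      rcases hg.bestResponse hP hi hB with rfl | ⟨s, hs, -, rfl⟩
      · exact ⟨x, L, S, K, rfl, hg⟩
      · exact ⟨x, L, S, _, rfl, hg.insert_link hs⟩
  | @enter n G t _ hs ht ih =>
    right
    have : ∃ L S, IsTuranSides n G L S := by
      rcases ih with ⟨rfl, rfl⟩ | ⟨x, L, S, K, rfl, hg⟩
      · exact ⟨_, _, isTuranSides_one⟩
      · exact hg.exists_isTuranSides hP hs
    obtain ⟨L, S, hT⟩ := this
    obtain ⟨L, S, hT, htL⟩ := hT.exists_of_entryResponse hP ht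
    exact ⟨n, L, S, {t}, rfl, hT.isGrowing_addLink htL⟩

theorem Arises.exists_isTuranSides (hP : Admissible P) (h : Arises P n G)
    (hs : PairwiseStable P n G) : 1 ≤ n ∧ ∃ L S, IsTuranSides n G L S := by
  rcases h.cases hP with ⟨rfl, rfl⟩ | ⟨x, L, S, K, rfl, hg⟩
  · exact ⟨le_rfl, _, _, isTuranSides_one⟩
  · exact ⟨by omega, hg.exists_isTuranSides hP hs⟩

theorem Arises.fairRun (hP : Admissible P) (h : Arises P n G) {m : ℕ → ℕ} {g : ℕ → SimpleGraph ℕ}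
    (hr : FairRun P n G m g) : ∃ N, PairwiseStable P n (g N) ∧ ∀ k ≥ N, g k = g N := by
  rcases h.cases hP with ⟨rfl, rfl⟩ | ⟨x, L, S, K, rfl, hg⟩
  · have hall : ∀ k, g k = ⊥ := by
      intro k
      induction k with
      | zero => exact hr.1
      | succ k ih =>
        have := hr.2.1 k
        rw [ih] at this
        exact bestResponse_one this.1 this.2
    exact ⟨0, hall 0 ▸ pairwiseStable_one, fun k _ => by rw [hall, hall]⟩
  · exact hg.fairRun hP hr

theorem IsGrowing.exists_arises (hP : Admissible P) {x : ℕ} {L S K : Finset ℕ}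
    (h : IsGrowing x G L S K) (hA : Arises P (x + 1) G) :
    ∃ H, Arises P (x + 1) H ∧ PairwiseStable P (x + 1) H := by
  induction hd : (L \ K).card using Nat.strong_induction_on generalizing G K with
  | _ d ih =>
  by_cases hK : K = L
  · exact ⟨G, hA, (h.pairwiseStable_iff hP).2 hK⟩
  · obtain ⟨s, hs, hs', hstep⟩ := h.exists_step hP hK
    exact ih _ (hd ▸ IsGrowing.card_sdiff_insert hs hs') (h.insert_link hs) (hA.move hstep) rfl

theorem exists_arises (hP : Admissible P) (hn : 1 ≤ n) :
    ∃ G, Arises P n G ∧ PairwiseStable P n G := by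
  induction n, hn using Nat.le_induction with
  | base => exact ⟨⊥, .start, pairwiseStable_one⟩
  | succ n hn ih =>
    obtain ⟨G, hA, hs⟩ := ih
    obtain ⟨-, L, S, hT⟩ := hA.exists_isTuranSides hP hs
    obtain ⟨t, ht⟩ := hT.exists_entryResponse hP hn
    obtain ⟨L, S, hT, htL⟩ := hT.exists_of_entryResponse hP ht
    exact (hT.isGrowing_addLink htL).exists_arises hP (hA.enter hs ht)

theorem IsTuranSides.exists_joinTo (hP : Admissible P) {L S : Finset ℕ} (h : IsTuranSides n G L S)
    {t : ℕ} (ht : t ∈ L) {H : SimpleGraph ℕ}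
    (hH : Relation.ReflTransGen (Step P (n + 1)) (addLink G n t) H) :
    ∃ K, t ∈ K ∧ K ⊆ L ∧ H = joinTo G n K := by
  induction hH with
  | refl => exact ⟨{t}, by simp, by simpa using ht, joinTo_singleton.symm⟩
  | tail _ hs ih =>
    obtain ⟨K, htK, hKL, rfl⟩ := ih
    obtain ⟨i, hi, hB⟩ := hs
    rcases (h.isGrowing hKL ⟨t, htK⟩).bestResponse hP hi hB with rfl | ⟨s, hs, -, rfl⟩
    · exact ⟨K, htK, hKL, rfl⟩
    · exact ⟨insert s K, by simp [htK], Finset.insert_subset hs hKL, addLink_joinTo⟩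

end Dynamics

end NetForm

theorem mainTheorem3 (P : NetForm.Params)
    (hb_nonneg : ∀ i, 1 ≤ i → 0 ≤ P.b i)
    (hb_anti : ∀ i, 1 ≤ i → P.b (i + 1) < P.b i)
    (hγ_nonneg : 0 ≤ P.γ)
    (hγ : P.γ < (P.b 2 - P.b 3) / (3 * P.b 2 - P.b 3))
    (hc_lower : P.b 1 - P.b 2 + P.γ * (3 * P.b 2 - P.b 3) < P.c)
    (hc_upper : P.c < P.b 1 - P.b 3)
    (hc₀_lower : (1 - P.γ) * (P.b 2 - P.b 3) < P.c₀)
    (hc₀_upper : P.c₀ ≤ (1 - P.γ) * P.b 2) :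
    -- every pairwise stable network that results is a bipartite Turán graph
    (∀ n G, NetForm.Arises P n G → NetForm.PairwiseStable P n G → NetForm.IsBipartiteTuran n G) ∧
    -- the adjustment process always settles at a pairwise stable network
    (∀ n G, NetForm.Arises P n G → ∀ m g, NetForm.FairRun P n G m g →
      ∃ K, NetForm.PairwiseStable P n (g K) ∧ ∀ k ≥ K, g k = g K) ∧
    -- every newly entering node enters
    (∀ n G, NetForm.Arises P n G → NetForm.PairwiseStable P n G →
      ∃ t, NetForm.EntryResponse P n G t) ∧
    -- pairwise stable networks of every size do result
    (∀ n, 1 ≤ n → ∃ G, NetForm.Arises P n G ∧ NetForm.PairwiseStable P n G) ∧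
    -- the new node first links to a node of the larger side, and then the only links that are ever
    -- altered are those that it creates with further nodes of that side, until it has them all
    (∀ n G, NetForm.Arises P n G → NetForm.PairwiseStable P n G →
      ∀ t, NetForm.EntryResponse P n G t →
        ∃ L S, NetForm.IsTuranSides n G L S ∧ t ∈ L ∧
          ∀ H, Relation.ReflTransGen (NetForm.Step P (n + 1)) (NetForm.addLink G n t) H →
            ∃ K, t ∈ K ∧ K ⊆ L ∧ H = NetForm.joinTo G n K ∧
              (NetForm.PairwiseStable P (n + 1) H ↔ K = L) ∧
              ∀ H', NetForm.Step P (n + 1) H H' →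
                H' = H ∨ ∃ s ∈ L \ K, H' = NetForm.addLink H n s) := by
  have hP : NetForm.Admissible P :=
    ⟨hb_nonneg, hb_anti, hγ_nonneg, hγ, hc_lower, hc_upper, hc₀_lower, hc₀_upper⟩
  refine ⟨fun n G hA hs => ?_, fun n G hA m g hr => hA.fairRun hP hr, fun n G hA hs => ?_,
    fun n hn => NetForm.exists_arises hP hn, fun n G hA hs t ht => ?_⟩
  · obtain ⟨-, L, S, hT⟩ := hA.exists_isTuranSides hP hs
    exact hT.isBipartiteTuran
  · obtain ⟨hn, L, S, hT⟩ := hA.exists_isTuranSides hP hs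
    exact hT.exists_entryResponse hP hn
  · obtain ⟨hn, L, S, hT⟩ := hA.exists_isTuranSides hP hs
    obtain ⟨L, S, hT, htL⟩ := hT.exists_of_entryResponse hP ht
    refine ⟨L, S, hT, htL, fun H hH => ?_⟩
    obtain ⟨K, htK, hKL, rfl⟩ := hT.exists_joinTo hP htL hH
    have hg := hT.isGrowing hKL ⟨t, htK⟩
    refine ⟨K, htK, hKL, rfl, hg.pairwiseStable_iff hP, ?_⟩
    rintro H' ⟨i, hi, hB⟩
    rcases hg.bestResponse hP hi hB with e | ⟨s, hs, hs', e⟩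
    · exact Or.inl e
    · exact Or.inr ⟨s, Finset.mem_sdiff.2 ⟨hs, hs'⟩, e⟩
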